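/- Let $d\in\{1,2,3\}$, let $(\Omega,\mathcal F,\mathbb P)$ be a probability space with an ergodic measure-preserving action $\tau=(\tau_k)_{k\in\mathbb Z^d}$ of $\mathbb Z^d$, and let $Q=[-\tfrac12,\tfrac12)^d$. A measurable function $f:\Omega\times\mathbb R^d\to\mathbb C$ is called *stationary* if, for every $k\in\mathbb Z^d$, $f(\tau_k\omega,x)=f(\omega,k+x)$ for a.e. $(\omega,x)$. For $1\le p,q\le\infty$ let $L^p_s(L^q)$ be the space of (classes of) stationary $f\in L^p(\Omega,L^q_{\rm loc}(\mathbb R^d))$, and $L^p_s=L^p_s(L^p)$. For $m>0$ let $W_m\in L^1(\mathbb R^d)$ be the real function with Fourier transform $$\widehat{W_m}(K)=(2\pi)^{-d/2}\int_{\mathbb R^d}W_m(x)e^{-iK\cdot x}\,dx=\frac{\sqrt{|S^{d-1}|}\,(2\pi)^{-d/2}}{\sqrt{m^2+|K|^2}},$$ where $|S^{d-1}|$ is the area of the unit sphere of $\mathbb R^d$ ($2$, $2\pi$, $4\pi$ for $d=1,2,3$), and put $(W_m*f)(\omega,x)=\int_{\mathbb R^d}f(\omega,y)W_m(x-y)\,dy$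 and $$D_m(f,f)=\mathbb E\int_Q|W_m*f|^2\,dx .$$ Let $\mathcal D_Y$ be the set of $f\in L^1_s$ such that $W_m*f\in L^2_s$ for every $m>0$, and let $\mathcal D_C$ be the set of $f\in\mathcal D_Y$ for which $$\lim_{m\to0^+}D_m\Big(f-\mathbb E\int_Qf,\;f-\mathbb E\int_Qf\Big)$$ exists and is finite (functions with finite Coulomb energy per unit volume). **Proposition.** Let $f\in L^2_s(L^q)$, where $q=1$ if $d=1$, $q>1$ if $d=2$, and $q=\tfrac65$ if $d=3$. If $$\int_Qf(\omega,x)\,dx=0\quad\text{and}\quad\int_Qx\,f(\omega,x)\,dx=0\qquad\text{for a.e. }\omega\in\Omega,$$ then $f\in\mathcal D_C$. -/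

import Mathlib

open MeasureTheory Set Filter Topology
open scoped ENNReal NNReal

namespace StationaryCoulomb

noncomputable section

/-- Euclidean space `ℝ^d`. -/
abbrev Space (d : ℕ) : Type := EuclideanSpace ℝ (Fin d)

/-- The lattice point `k ∈ ℤ^d`, seen in `ℝ^d`. -/
def latticePoint {d : ℕ} (k : Fin d → ℤ) : Space d := WithLp.toLp 2 (fun i => (k i : ℝ))

/-- The semi-open unit cell `Q = [-1/2, 1/2)^d`. -/
def unitCell (d : ℕ) : Set (Space d) := {x | ∀ i, x i ∈ Ico (-(1 / 2) : ℝ) (1 / 2)}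

/-- The surface measure `|S^{d-1}|` of the unit sphere of `ℝ^d`
(`2`, `2π`, `4π` for `d = 1, 2, 3`). -/
def sphereArea (d : ℕ) : ℝ :=
  ((volume : Measure (Space d)).toSphere : Measure (Metric.sphere (0 : Space d) 1)).real univ

/-- The Fourier transform of a real function, with the convention
`(2π)^{-d/2} ∫ w(x) e^{-i K·x} dx`. -/
def fourierHat {d : ℕ} (w : Space d → ℝ) (K : Space d) : ℂ :=
  (((2 * Real.pi) ^ (-(d : ℝ) / 2) : ℝ) : ℂ) *
    ∫ x, (w x : ℂ) * Complex.exp (-(Complex.I * (inner ℝ K x : ℝ)))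

/-- `w` is (a representative of) the integrable function `W_m` whose Fourier transform is
`√|S^{d-1}| (2π)^{-d/2} / √(m² + |K|²)`. -/
structure IsYukawaSqrtKernel {d : ℕ} (m : ℝ) (w : Space d → ℝ) : Prop where
  integrable : Integrable w
  fourier_eq : ∀ K : Space d, fourierHat w K =
    ((√(sphereArea d) * (2 * Real.pi) ^ (-(d : ℝ) / 2) / √(m ^ 2 + ‖K‖ ^ 2) : ℝ) : ℂ)

lemma integrable_heat {d : ℕ} {t : ℝ} (ht : 0 < t) :
    Integrable (fun x : Space d => Real.exp (-(‖x‖ ^ 2 / (4 * t)))) := by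
  have hb : 0 < (((1 / (4 * t) : ℝ)) : ℂ).re := by
    rw [Complex.ofReal_re]; positivity
  have h := (GaussianFourier.integrable_cexp_neg_mul_sq_norm_add (V := Space d) hb 0 0).re
  refine h.congr (ae_of_all _ fun x => ?_)
  have : (-(((1 / (4 * t) : ℝ)) : ℂ) * (‖x‖ : ℂ) ^ 2 + 0 * ((inner ℝ (0 : Space d) x : ℝ) : ℂ))
      = ((-(‖x‖ ^ 2 / (4 * t)) : ℝ) : ℂ) := by
    push_cast; ring
  simp only [this]
  exact Complex.exp_ofReal_re _

lemma integral_heat_fourier {d : ℕ} {t : ℝ} (ht : 0 < t) (K : Space d) :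
    ∫ x : Space d, ((Real.exp (-(‖x‖ ^ 2 / (4 * t))) : ℝ) : ℂ) *
      Complex.exp (-(Complex.I * (inner ℝ K x : ℝ))) =
      (((4 * Real.pi * t) ^ ((d : ℝ) / 2) * Real.exp (-(t * ‖K‖ ^ 2)) : ℝ) : ℂ) := by
  have hb : 0 < (((1 / (4 * t) : ℝ)) : ℂ).re := by
    rw [Complex.ofReal_re]; positivity
  have h := GaussianFourier.integral_cexp_neg_mul_sq_norm_add (V := Space d) hb (-Complex.I) K
  have htc : (t : ℂ) ≠ 0 := by exact_mod_cast ht.ne'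
  calc _ = ∫ v : Space d, Complex.exp (-(((1 / (4 * t) : ℝ)) : ℂ) * (‖v‖ : ℂ) ^ 2 +
        (-Complex.I) * ((inner ℝ K v : ℝ) : ℂ)) := by
        refine integral_congr_ae (ae_of_all _ fun x => ?_)
        simp only [Complex.ofReal_exp, ← Complex.exp_add]
        congr 1
        push_cast; ring
    _ = _ := by
        rw [h]
        have e1 : (Real.pi : ℂ) / (((1 / (4 * t) : ℝ)) : ℂ) = ((4 * Real.pi * t : ℝ) : ℂ) := by
          push_cast; field_simp
        rw [e1, Complex.ofReal_mul ((4 * Real.pi * t) ^ ((d : ℝ) / 2)),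
          Complex.ofReal_cpow (by positivity), Complex.ofReal_exp]
        congr 1
        · simp
        · congr 1
          push_cast
          rw [neg_sq, Complex.I_sq]
          field_simp

lemma integral_heat {d : ℕ} {t : ℝ} (ht : 0 < t) :
    ∫ x : Space d, Real.exp (-(‖x‖ ^ 2 / (4 * t))) = (4 * Real.pi * t) ^ ((d : ℝ) / 2) := by
  have h := integral_heat_fourier (d := d) ht 0
  simp only [inner_zero_left, Complex.ofReal_zero, mul_zero, neg_zero, Complex.exp_zero, mul_one,
    norm_zero, ne_eq, OfNat.ofNat_ne_zero, not_false_eq_true, zero_pow, Real.exp_zero] at h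
  rw [integral_complex_ofReal] at h
  exact_mod_cast h

/-- The superposition of heat kernels used to show that `W_m` exists. -/
def heatMix {d : ℕ} (m : ℝ) (p : Space d × ℝ) : ℝ :=
  (p.2 ^ ((1 / 2 : ℝ) - 1) * Real.exp (-(m ^ 2 * p.2))) *
    ((4 * Real.pi * p.2) ^ (-((d : ℝ) / 2)) * Real.exp (-(‖p.1‖ ^ 2 / (4 * p.2))))

lemma measurable_heatMix {d : ℕ} (m : ℝ) : Measurable (heatMix (d := d) m) := by
  unfold heatMix; fun_prop

lemma integrable_heatMix {d : ℕ} {m : ℝ} (hm : 0 < m) :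
    Integrable (heatMix (d := d) m) ((volume : Measure (Space d)).prod
      ((volume : Measure ℝ).restrict (Ioi 0))) := by
  rw [integrable_prod_iff' (measurable_heatMix m).aestronglyMeasurable]
  constructor
  · filter_upwards [ae_restrict_mem measurableSet_Ioi] with t ht
    exact ((integrable_heat (d := d) ht).const_mul
      ((4 * Real.pi * t) ^ (-((d : ℝ) / 2)))).const_mul
      (t ^ ((1 / 2 : ℝ) - 1) * Real.exp (-(m ^ 2 * t)))
  · have hi : IntegrableOn (fun t : ℝ => t ^ ((1 / 2 : ℝ) - 1) * Real.exp (-(m ^ 2 * t)))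
        (Ioi 0) := by
      have := integrableOn_rpow_mul_exp_neg_mul_rpow (p := 1) (s := (1 / 2 : ℝ) - 1)
        (b := m ^ 2) (by norm_num) one_pos (by positivity)
      simpa using this
    refine hi.congr ?_
    filter_upwards [ae_restrict_mem measurableSet_Ioi] with t ht
    have ht : 0 < t := ht
    have hn : ∀ x : Space d, ‖heatMix m (x, t)‖ = heatMix m (x, t) := fun x => by
      refine Real.norm_of_nonneg ?_
      unfold heatMix; positivity
    simp only [hn]
    unfold heatMix
    simp only
    rw [integral_const_mul, integral_const_mul, integral_heat ht, ← Real.rpow_add (by positivity)]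
    simp

/-- `W_m` exists for every `m > 0`. -/
theorem exists_isYukawaSqrtKernel (d : ℕ) {m : ℝ} (hm : 0 < m) :
    ∃ w : Space d → ℝ, IsYukawaSqrtKernel m w := by
  refine ⟨fun x => (√(sphereArea d) / √Real.pi) * ∫ t in Ioi 0, heatMix m (x, t), ?_, ?_⟩
  · exact (integrable_heatMix hm).integral_prod_left.const_mul _
  · intro K
    have hint : Integrable (fun p : Space d × ℝ => ((heatMix m p : ℝ) : ℂ) *
        Complex.exp (-(Complex.I * (inner ℝ K p.1 : ℝ))))
        ((volume : Measure (Space d)).prod ((volume : Measure ℝ).restrict (Ioi 0))) := by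
      refine (integrable_heatMix hm).ofReal.mul_bdd (c := 1) ?_ (ae_of_all _ fun p => ?_)
      · exact (by fun_prop : Continuous fun p : Space d × ℝ =>
          Complex.exp (-(Complex.I * (inner ℝ K p.1 : ℝ)))).aestronglyMeasurable
      · rw [show -(Complex.I * ((inner ℝ K p.1 : ℝ) : ℂ)) =
          ((-(inner ℝ K p.1 : ℝ) : ℝ) : ℂ) * Complex.I by push_cast; ring,
          Complex.norm_exp_ofReal_mul_I]
    have key : ∫ x : Space d, ((∫ t in Ioi 0, heatMix m (x, t) : ℝ) : ℂ) *
        Complex.exp (-(Complex.I * (inner ℝ K x : ℝ))) =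
        ((√Real.pi / √(m ^ 2 + ‖K‖ ^ 2) : ℝ) : ℂ) := by
      calc _ = ∫ x : Space d, ∫ t in Ioi (0 : ℝ), ((heatMix m (x, t) : ℝ) : ℂ) *
            Complex.exp (-(Complex.I * (inner ℝ K x : ℝ))) := by
            refine integral_congr_ae (ae_of_all _ fun x => ?_)
            simp only
            rw [integral_mul_const, integral_complex_ofReal]
        _ = ∫ t in Ioi (0 : ℝ), ∫ x : Space d, ((heatMix m (x, t) : ℝ) : ℂ) *
            Complex.exp (-(Complex.I * (inner ℝ K x : ℝ))) := integral_integral_swap hint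
        _ = ∫ t in Ioi (0 : ℝ), ((t ^ ((1 / 2 : ℝ) - 1) *
            Real.exp (-((m ^ 2 + ‖K‖ ^ 2) * t)) : ℝ) : ℂ) := by
            refine setIntegral_congr_fun measurableSet_Ioi fun t ht => ?_
            have ht : 0 < t := ht
            simp only [heatMix, Complex.ofReal_mul, mul_assoc]
            rw [integral_const_mul, integral_const_mul, integral_const_mul,
              integral_heat_fourier ht K]
            simp only [← Complex.ofReal_mul]
            congr 1
            have h1 : (4 * (Real.pi * t)) ^ (-((d : ℝ) / 2)) *
                (4 * Real.pi * t) ^ ((d : ℝ) / 2) = 1 := by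
              rw [← mul_assoc, ← Real.rpow_add (by positivity)]; simp
            rw [← mul_assoc ((4 * (Real.pi * t)) ^ (-((d : ℝ) / 2))), h1, one_mul,
              ← Real.exp_add]
            congr 2; ring
        _ = _ := by
            rw [integral_complex_ofReal,
              Real.integral_rpow_mul_exp_neg_mul_Ioi (by norm_num) (by positivity),
              Real.Gamma_one_half_eq, ← Real.sqrt_eq_rpow, Real.sqrt_div' _ (by positivity),
              Real.sqrt_one]
            congr 1; ring
    unfold fourierHat
    simp only [Complex.ofReal_mul, mul_assoc]
    rw [integral_const_mul, key, ← Complex.ofReal_mul, ← Complex.ofReal_mul]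
    congr 1
    have : √Real.pi ≠ 0 := by positivity
    field_simp

/-- `W_m` is unique up to a null set. -/
theorem IsYukawaSqrtKernel.ae_eq {d : ℕ} {m : ℝ} {w₁ w₂ : Space d → ℝ}
    (h₁ : IsYukawaSqrtKernel m w₁) (h₂ : IsYukawaSqrtKernel m w₂) : w₁ =ᵐ[volume] w₂ := by
  have hexp : ∀ (w : Space d → ℝ), Integrable w → ∀ K : Space d, Integrable (fun x =>
      ((w x : ℝ) : ℂ) * Complex.exp (-(Complex.I * (inner ℝ K x : ℝ)))) := by
    intro w hw K
    refine hw.ofReal.mul_bdd (c := 1) ?_ (ae_of_all _ fun x => ?_)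
    · exact (by fun_prop : Continuous fun x : Space d =>
        Complex.exp (-(Complex.I * (inner ℝ K x : ℝ)))).aestronglyMeasurable
    · rw [show -(Complex.I * ((inner ℝ K x : ℝ) : ℂ)) =
        ((-(inner ℝ K x : ℝ) : ℝ) : ℂ) * Complex.I by push_cast; ring,
        Complex.norm_exp_ofReal_mul_I]
  set f : Space d → ℂ := fun x => ((w₁ x - w₂ x : ℝ) : ℂ) with hf
  have hw : Integrable f := (h₁.integrable.sub h₂.integrable).ofReal
  have h0 : ∀ K : Space d, ∫ x, f x * Complex.exp (-(Complex.I * (inner ℝ K x : ℝ))) = 0 := by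
    intro K
    have h := (h₁.fourier_eq K).trans (h₂.fourier_eq K).symm
    unfold fourierHat at h
    have hc : (((2 * Real.pi) ^ (-(d : ℝ) / 2) : ℝ) : ℂ) ≠ 0 := by
      have : (0 : ℝ) < (2 * Real.pi) ^ (-(d : ℝ) / 2) := by positivity
      exact_mod_cast this.ne'
    have h := mul_left_cancel₀ hc h
    simp only [hf, Complex.ofReal_sub, sub_mul]
    rw [integral_sub (hexp _ h₁.integrable K) (hexp _ h₂.integrable K), h, sub_self]
  have hF : ∀ ξ : Space d, FourierTransform.fourier f ξ = 0 := by
    intro ξ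
    rw [Real.fourier_eq']
    rw [← h0 ((2 * Real.pi) • ξ)]
    refine integral_congr_ae (ae_of_all _ fun x => ?_)
    simp only [smul_eq_mul]
    rw [mul_comm, inner_smul_left, real_inner_comm]
    congr 2
    simp
    ring
  have hz : ∀ᵐ x : Space d, f x = 0 := by
    refine ae_eq_zero_of_integral_contDiff_smul_eq_zero hw.locallyIntegrable fun g hg hgs => ?_
    have hgs' : HasCompactSupport (fun x => (g x : ℂ)) := hgs.comp_left (g := fun y : ℝ => (y : ℂ)) rfl
    have hg' : ContDiff ℝ (⊤ : ℕ∞) (fun x => (g x : ℂ)) := Complex.ofRealCLM.contDiff.comp hg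
    set φ : SchwartzMap (Space d) ℂ := hgs'.toSchwartzMap hg' with hφ
    have hflip := VectorFourier.integral_fourierIntegral_smul_eq_flip (L := innerₗ (Space d))
      Real.continuous_fourierChar continuous_inner
      ((FourierTransformInv.fourierInv φ).integrable (μ := volume)) hw
    have e1 : ∀ x, VectorFourier.fourierIntegral Real.fourierChar volume (innerₗ (Space d))
        (FourierTransformInv.fourierInv φ) x = (g x : ℂ) := by
      intro x
      have : FourierTransform.fourier (FourierTransformInv.fourierInv φ) x = φ x := by simp
      exact this
    have e2 : ∀ x, VectorFourier.fourierIntegral Real.fourierChar volume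
        (innerₗ (Space d)).flip f x = 0 := by
      intro x
      rw [← hF x, flip_innerₗ]
      rfl
    simp only [e1, e2, smul_zero, integral_zero] at hflip
    rw [← hflip]
    refine integral_congr_ae (ae_of_all _ fun x => ?_)
    simp
  filter_upwards [hz] with x hx
  simp only [hf, Complex.ofReal_eq_zero] at hx
  linarith

/-- The kernel `W_m`, for `m > 0` (and `0` otherwise). -/
def yukawaSqrtKernel (d : ℕ) (m : ℝ) : Space d → ℝ :=
  if hm : 0 < m then (exists_isYukawaSqrtKernel d hm).choose else 0

theorem isYukawaSqrtKernel {d : ℕ} {m : ℝ} (hm : 0 < m) :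
    IsYukawaSqrtKernel m (yukawaSqrtKernel d m) := by
  rw [yukawaSqrtKernel, dif_pos hm]
  exact (exists_isYukawaSqrtKernel d hm).choose_spec

section Stationary

variable {d : ℕ} {Ω : Type*} [MeasurableSpace Ω] [AddAction (Fin d → ℤ) Ω]

/-- `f` is stationary: `f(τ_k ω, x) = f(ω, k + x)` almost surely and almost everywhere. The action
`τ` of `ℤ^d` on `Ω` is written `τ_k ω = k +ᵥ ω`. -/
def IsStationary (P : Measure Ω) (f : Ω × Space d → ℂ) : Prop :=
  ∀ k : Fin d → ℤ, ∀ᵐ z : Ω × Space d ∂(P.prod volume),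
    f (k +ᵥ z.1, z.2) = f (z.1, latticePoint k + z.2)

/-- `f ∈ L^p_s(L^q)`: `f` is (jointly) measurable, stationary, and belongs to
`L^p(Ω, L^q_loc(ℝ^d))`, that is, `ω ↦ ‖f(ω, ·)‖_{L^q(K)}` is in `L^p(Ω)` for every compact `K`.
Functions are taken up to almost everywhere equality. -/
structure MemLs (P : Measure Ω) (p q : ℝ≥0∞) (f : Ω × Space d → ℂ) : Prop where
  aestronglyMeasurable : AEStronglyMeasurable f (P.prod volume)
  stationary : IsStationary P f
  eLpNorm_lt_top : ∀ K : Set (Space d), IsCompact K →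
    eLpNorm (fun ω => eLpNorm (fun x => f (ω, x)) q (volume.restrict K)) p P < ∞

/-- The convolution `(W_m * f)(ω, x) = ∫ f(ω, y) W_m(x - y) dy`. -/
def yukawaConv (m : ℝ) (f : Ω × Space d → ℂ) (z : Ω × Space d) : ℂ :=
  ∫ y, f (z.1, y) * (yukawaSqrtKernel d m (z.2 - y) : ℂ)

/-- The Yukawa energy per unit volume `D_m(f, f) = 𝔼 ∫_Q |W_m * f|²`, in `[0, ∞]`. -/
def yukawaEnergy (P : Measure Ω) (m : ℝ) (f : Ω × Space d → ℂ) : ℝ≥0∞ :=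
  ∫⁻ ω, (∫⁻ x in unitCell d, ‖yukawaConv m f (ω, x)‖ₑ ^ 2) ∂P

/-- `f ∈ 𝒟_Y`: `f ∈ L^1_s` and, for every `m > 0`, `W_m * f` is well defined and lies in `L^2_s`. -/
structure MemDY (P : Measure Ω) (f : Ω × Space d → ℂ) : Prop where
  memLs : MemLs P 1 1 f
  integrable_conv : ∀ m : ℝ, 0 < m → ∀ᵐ z : Ω × Space d ∂(P.prod volume),
    Integrable (fun y => f (z.1, y) * (yukawaSqrtKernel d m (z.2 - y) : ℂ))
  memLs_conv : ∀ m : ℝ, 0 < m → MemLs P 2 2 (yukawaConv m f)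

/-- The mean charge `𝔼 ∫_Q f` per unit volume. -/
def meanCharge (P : Measure Ω) (f : Ω × Space d → ℂ) : ℂ :=
  ∫ ω, (∫ x in unitCell d, f (ω, x)) ∂P

/-- `f ∈ 𝒟_C`: `f ∈ 𝒟_Y` and `D_m(f - 𝔼 ∫_Q f, f - 𝔼 ∫_Q f)` has a finite limit as `m → 0`. -/
structure MemDC (P : Measure Ω) (f : Ω × Space d → ℂ) : Prop where
  memDY : MemDY P f
  finite_limit : ∃ D₀ : ℝ≥0,
    Tendsto (fun m : ℝ => yukawaEnergy P m (fun z => f z - meanCharge P f)) (𝓝[>] 0)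
      (𝓝 (D₀ : ℝ≥0∞))

/-- The charge `∫_Q f(ω, x) dx` of `f` in the unit cell. -/
def cellCharge (f : Ω × Space d → ℂ) (ω : Ω) : ℂ :=
  ∫ x in unitCell d, f (ω, x)

/-- The dipole moment `∫_Q x f(ω, x) dx ∈ ℂ^d` of `f` in the unit cell. -/
def cellDipole (f : Ω × Space d → ℂ) (ω : Ω) : Fin d → ℂ :=
  fun i => ∫ x in unitCell d, (x i : ℂ) * f (ω, x)

end Stationary

end

end StationaryCoulomb

/-! Up to a constant, `W_m` is the superposition `∫₀^∞ t^{-1/2} e^{-m² t} G_t dt` of heat kernels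
`G_t`. As `m → 0` the only obstruction to integrability in `y` is the slow decay `t^{-1/2}` of the
weight at large times. By stationarity and invariance of `P`, almost every `f(ω, ·)` has zero charge
and zero dipole moment in every cell `Q + k`. Hence, for `t > 1`, the first order Taylor polynomial
of `y ↦ G_t(x - y)` at the centre of each cell can be subtracted without changing `W_m * f`
(`CellNeutral.integral_mul_yukawaSqrtKernel`). The remainder is `O(t⁻¹ G_{4t}(x - y))`
(`exists_abs_heatRemainder_le`), so the weight becomes `t^{-3/2}`, integrable at infinity. All the
subtracted kernels are then bounded, uniformly in `m`, by a constant times a fixed integrable kernel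
`majorant (x - y)`, and they converge pointwise as `m → 0`.

Everything reduces, by dominated convergence on `Ω × Q`, to the finiteness of `𝔼 ∫_Q (majorant *
|f|)²` (`lintegral_lintegral_majorant_sq_lt_top`). The singular part of `majorant` near the origin
comes from times `t ≤ 1` and is controlled by an inequality of Hardy–Littlewood–Sobolev type from
`L^q` to `L²` (`exists_lintegral_smallKernel_sq_le`); this is where the conditions on `q` enter, `q
= 6/5` being critical for `d = 3`. The remaining part varies slowly on the scale of a cell, so its
convolution with `|f|` is a weighted sum of the cell masses of `|f|`, whose second moments are all
equal by stationarity (`lintegral_lintegral_kernel_sq_le`).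

For a fixed `m > 0` the factor `e^{-m² t}` replaces the Taylor subtraction, and the same bound
yields `f ∈ 𝒟_Y`. -/

namespace StationaryCoulomb

noncomputable section

/-! ### Weighted Jensen inequalities, lattice cells, and averaging over cells. -/

/-- Jensen's inequality for the weight `k`, in the form of Hölder's inequality. -/
lemma lintegral_mul_rpow_le {α : Type*} [MeasurableSpace α] (μ : Measure α) {q : ℝ} (hq : 1 ≤ q)
    {k f : α → ℝ≥0∞} (hk : AEMeasurable k μ) (hf : AEMeasurable f μ) :
    (∫⁻ x, k x * f x ∂μ) ^ q ≤ (∫⁻ x, k x ∂μ) ^ (q - 1) * ∫⁻ x, k x * f x ^ q ∂μ := by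
  rcases hq.eq_or_lt with rfl | hq1
  · simp
  have hq0 : 0 < q := by linarith
  have hpq : (q / (q - 1)).HolderConjugate q :=
    (Real.HolderConjugate.conjExponent hq1).symm
  -- Hölder is applied to the factorisation `k f = k^{1 - 1/q} · (k^{1/q} f)`.
  have h := ENNReal.lintegral_mul_le_Lp_mul_Lq μ hpq (hk.pow_const (1 - 1 / q))
    ((hk.pow_const (1 / q)).mul hf)
  have e1 : ∀ x, ((fun x => k x ^ (1 - 1 / q)) * ((fun x => k x ^ (1 / q)) * f)) x = k x * f x := by
    intro x
    have h1 : (1 : ℝ) / q ≤ 1 := by rw [div_le_one hq0]; exact hq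
    simp only [Pi.mul_apply]
    rw [← mul_assoc, ← ENNReal.rpow_add_of_nonneg _ _ (by linarith) (by positivity)]
    simp
  have e2 : ∀ x, (k x ^ (1 - 1 / q)) ^ (q / (q - 1)) = k x := by
    intro x
    rw [← ENNReal.rpow_mul]
    have : (1 - 1 / q) * (q / (q - 1)) = 1 := by
      have : q - 1 ≠ 0 := by linarith
      field_simp
    rw [this, ENNReal.rpow_one]
  have e3 : ∀ x, (k x ^ (1 / q) * f x) ^ q = k x * f x ^ q := by
    intro x
    rw [ENNReal.mul_rpow_of_nonneg _ _ hq0.le, ← ENNReal.rpow_mul, one_div_mul_cancel hq0.ne',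
      ENNReal.rpow_one]
  rw [lintegral_congr e1, lintegral_congr e2] at h
  simp only [Pi.mul_apply, e3] at h
  calc (∫⁻ x, k x * f x ∂μ) ^ q
      ≤ ((∫⁻ x, k x ∂μ) ^ (1 / (q / (q - 1))) * (∫⁻ x, k x * f x ^ q ∂μ) ^ (1 / q)) ^ q := by
        gcongr
    _ = _ := by
        rw [ENNReal.mul_rpow_of_nonneg _ _ hq0.le, ← ENNReal.rpow_mul, ← ENNReal.rpow_mul,
          one_div_mul_cancel hq0.ne', ENNReal.rpow_one]
        congr 2
        field_simp

lemma lintegral_mul_sq_le {α : Type*} [MeasurableSpace α] (μ : Measure α)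
    {k f : α → ℝ≥0∞} (hk : AEMeasurable k μ) (hf : AEMeasurable f μ) :
    (∫⁻ x, k x * f x ∂μ) ^ 2 ≤ (∫⁻ x, k x ∂μ) * ∫⁻ x, k x * f x ^ 2 ∂μ := by
  have h := lintegral_mul_rpow_le μ (q := 2) (by norm_num) hk hf
  norm_num at h
  exact h

lemma tsum_mul_sq_le {ι : Type*} (b N : ι → ℝ≥0∞) :
    (∑' i, b i * N i) ^ 2 ≤ (∑' i, b i) * ∑' i, b i * N i ^ 2 := by
  let _ : MeasurableSpace ι := ⊤
  have h := lintegral_mul_sq_le (Measure.count : Measure ι) (k := b) (f := N)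
    (measurable_from_top).aemeasurable (measurable_from_top).aemeasurable
  have : MeasurableSingletonClass ι := ⟨fun _ => trivial⟩
  simpa only [lintegral_count] using h

variable {d : ℕ}

/-- The lattice point whose cell contains `y`. -/
def cellIndex (y : Space d) : Fin d → ℤ := fun i => ⌊y i + 1 / 2⌋

lemma measurable_cellIndex : Measurable (cellIndex (d := d)) := by
  refine measurable_pi_lambda _ fun i => Int.measurable_floor.comp ?_
  fun_prop

/-- The translate `Q + k` of the unit cell. -/
def cell (k : Fin d → ℤ) : Set (Space d) := {y | cellIndex y = k}

lemma mem_cell_iff {k : Fin d → ℤ} {y : Space d} :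
    y ∈ cell k ↔ ∀ i, y i - k i ∈ Ico (-(1 / 2) : ℝ) (1 / 2) := by
  simp only [cell, mem_ofPred_eq, funext_iff, cellIndex, Int.floor_eq_iff, mem_Ico]
  refine forall_congr' fun i => ⟨fun h => ⟨by linarith, by linarith⟩,
    fun h => ⟨by linarith, by linarith⟩⟩

lemma latticePoint_add_mem_cell {k : Fin d → ℤ} {x : Space d} :
    latticePoint k + x ∈ cell k ↔ x ∈ unitCell d := by
  simp [mem_cell_iff, unitCell, latticePoint]

lemma measurableSet_cell (k : Fin d → ℤ) : MeasurableSet (cell (d := d) k) :=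
  measurable_cellIndex (measurableSet_singleton k)

lemma cell_zero : cell (d := d) 0 = unitCell d := by
  ext y; simp [mem_cell_iff, unitCell]

lemma pairwise_disjoint_cell : Pairwise (Function.onFun Disjoint (cell (d := d))) := by
  intro k l hkl
  refine Set.disjoint_left.2 fun y hy hy' => hkl ?_
  exact (show cellIndex y = k from hy).symm.trans hy'

lemma iUnion_cell : ⋃ k, cell (d := d) k = univ :=
  eq_univ_of_forall fun y => mem_iUnion.2 ⟨cellIndex y, rfl⟩

lemma lintegral_eq_tsum_cell (h : Space d → ℝ≥0∞) :
    ∫⁻ y, h y = ∑' k : Fin d → ℤ, ∫⁻ y in cell k, h y := by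
  rw [← lintegral_iUnion measurableSet_cell pairwise_disjoint_cell, iUnion_cell,
    Measure.restrict_univ]

lemma measurePreserving_latticePoint_add (k : Fin d → ℤ) :
    MeasurePreserving (fun x : Space d => latticePoint k + x)
      (volume.restrict (unitCell d)) (volume.restrict (cell k)) := by
  have h := (measurePreserving_add_left (volume : Measure (Space d))
    (latticePoint k)).restrict_preimage (measurableSet_cell k)
  convert h using 2
  ext x
  exact latticePoint_add_mem_cell.symm

lemma measurableEmbedding_latticePoint_add (k : Fin d → ℤ) :
    MeasurableEmbedding (fun x : Space d => latticePoint k + x) :=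
  measurableEmbedding_addLeft _

lemma volume_unitCell : volume (unitCell d) = 1 := by
  have e : unitCell d = (MeasurableEquiv.toLp 2 (Fin d → ℝ)).symm ⁻¹'
      (Set.pi univ fun _ => Ico (-(1 / 2) : ℝ) (1 / 2)) := by
    ext y; simp [unitCell]
  rw [e, (EuclideanSpace.volume_preserving_symm_measurableEquiv_toLp (Fin d)).measure_preimage_equiv,
    volume_pi_pi]
  norm_num

lemma volume_cell (k : Fin d → ℤ) : volume (cell (d := d) k) = 1 := by
  have h := (measurePreserving_latticePoint_add (d := d) k).measure_preimage
    (s := univ) MeasurableSet.univ.nullMeasurableSet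
  simpa [volume_unitCell] using h.symm

lemma norm_sub_sq_le_of_mem_cell {k : Fin d → ℤ} {y y' : Space d} (hy : y ∈ cell k)
    (hy' : y' ∈ cell k) : ‖y - y'‖ ^ 2 ≤ d := by
  rw [EuclideanSpace.norm_sq_eq]
  calc ∑ i, ‖(y - y') i‖ ^ 2 ≤ ∑ _i : Fin d, (1 : ℝ) := by
        refine Finset.sum_le_sum fun i _ => ?_
        have h1 := mem_cell_iff.1 hy i
        have h2 := mem_cell_iff.1 hy' i
        rw [mem_Ico] at h1 h2
        have : |(y - y') i| ≤ 1 := by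
          simp only [PiLp.sub_apply]
          rw [abs_le]; constructor <;> linarith
        rw [Real.norm_eq_abs]
        exact pow_le_one₀ (abs_nonneg _) this
    _ = d := by simp

lemma latticePoint_mem_cell (k : Fin d → ℤ) : latticePoint k ∈ cell (d := d) k := by
  simp [mem_cell_iff, latticePoint]

/-- If `κ(x - y) ≤ κ'(x - y')` for `y, y'` in the same cell, then `κ * F` is bounded by the
superposition of the cell masses of `F` with weights summing to `∫ κ'`. -/
lemma lintegral_kernel_sq_le {κ κ' : Space d → ℝ≥0∞}
    (hcell : ∀ (k : Fin d → ℤ) (x y y' : Space d), y ∈ cell k → y' ∈ cell k →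
      κ (x - y) ≤ κ' (x - y')) (F : Space d → ℝ≥0∞) (hF : Measurable F) (x : Space d) :
    (∫⁻ y, κ (x - y) * F y) ^ 2 ≤
      (∫⁻ z, κ' z) * ∑' k : Fin d → ℤ, (∫⁻ y in cell k, κ' (x - y)) *
        (∫⁻ y in cell k, F y) ^ 2 := by
  have hb : ∑' k : Fin d → ℤ, (∫⁻ y in cell k, κ' (x - y)) = ∫⁻ z, κ' z := by
    rw [← lintegral_eq_tsum_cell (fun y => κ' (x - y)), lintegral_sub_left_eq_self]
  calc (∫⁻ y, κ (x - y) * F y) ^ 2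
      ≤ (∑' k : Fin d → ℤ, (∫⁻ y in cell k, κ' (x - y)) * (∫⁻ y in cell k, F y)) ^ 2 := by
        rw [lintegral_eq_tsum_cell]
        gcongr with k
        rw [← lintegral_const_mul _ hF]
        refine setLIntegral_mono' (measurableSet_cell k) fun y hy => ?_
        gcongr
        -- A cell has volume one, so a constant is its own integral over `y'`.
        calc κ (x - y) = ∫⁻ _ in cell k, κ (x - y) := by simp [volume_cell]
          _ ≤ _ := setLIntegral_mono' (measurableSet_cell k) fun y' hy' => hcell k x y y' hy hy'
    _ ≤ _ := tsum_mul_sq_le _ _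
    _ = _ := by rw [hb]

variable {Ω : Type*} [AddAction (Fin d → ℤ) Ω]

lemma lintegral_cell_of_stationary {F : Ω → Space d → ℝ≥0∞} {ω : Ω} {k : Fin d → ℤ}
    (h : ∀ᵐ x, F (k +ᵥ ω) x = F ω (latticePoint k + x)) :
    ∫⁻ y in cell k, F ω y = ∫⁻ x in unitCell d, F (k +ᵥ ω) x := by
  rw [← (measurePreserving_latticePoint_add k).lintegral_comp_emb
    (measurableEmbedding_latticePoint_add k)]
  exact lintegral_congr_ae (ae_restrict_of_ae (h.mono fun x hx => hx.symm))

variable [MeasurableSpace Ω]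

/-- Smoothing on the scale of the cells: the second moment of `κ * F` is bounded by that of the
mass of `F` in the unit cell. -/
lemma lintegral_lintegral_kernel_sq_le (P : Measure Ω)
    [MeasurableConstVAdd (Fin d → ℤ) Ω] [VAddInvariantMeasure (Fin d → ℤ) Ω P]
    {κ κ' : Space d → ℝ≥0∞}
    (hcell : ∀ (k : Fin d → ℤ) (x y y' : Space d), y ∈ cell k → y' ∈ cell k →
      κ (x - y) ≤ κ' (x - y')) {F : Ω → Space d → ℝ≥0∞}
    (hF : Measurable (Function.uncurry F))
    (hs : ∀ k : Fin d → ℤ, ∀ᵐ ω ∂P, ∀ᵐ x, F (k +ᵥ ω) x = F ω (latticePoint k + x))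
    (x : Space d) :
    ∫⁻ ω, (∫⁻ y, κ (x - y) * F ω y) ^ 2 ∂P ≤
      (∫⁻ z, κ' z) ^ 2 * ∫⁻ ω, (∫⁻ y in unitCell d, F ω y) ^ 2 ∂P := by
  have hN : ∀ k : Fin d → ℤ, Measurable fun ω => ∫⁻ y in cell k, F ω y := fun k =>
    hF.lintegral_prod_right'
  calc ∫⁻ ω, (∫⁻ y, κ (x - y) * F ω y) ^ 2 ∂P
      ≤ ∫⁻ ω, (∫⁻ z, κ' z) * ∑' k : Fin d → ℤ, (∫⁻ y in cell k, κ' (x - y)) *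
        (∫⁻ y in cell k, F ω y) ^ 2 ∂P :=
        lintegral_mono fun ω => lintegral_kernel_sq_le hcell _ (by fun_prop) x
    _ = (∫⁻ z, κ' z) * ∑' k : Fin d → ℤ, (∫⁻ y in cell k, κ' (x - y)) *
        ∫⁻ ω, (∫⁻ y in cell k, F ω y) ^ 2 ∂P := by
        rw [lintegral_const_mul _ (by fun_prop), lintegral_tsum (by fun_prop)]
        congr 2 with k
        rw [lintegral_const_mul _ (by fun_prop)]
    _ = (∫⁻ z, κ' z) * ∑' k : Fin d → ℤ, (∫⁻ y in cell k, κ' (x - y)) *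
        ∫⁻ ω, (∫⁻ y in unitCell d, F ω y) ^ 2 ∂P := by
        congr 2 with k
        congr 1
        -- The second moment of the cell mass does not depend on `k`, so only the weights remain to
        -- be summed over the cells.
        calc ∫⁻ ω, (∫⁻ y in cell k, F ω y) ^ 2 ∂P
            = ∫⁻ ω, (∫⁻ x in unitCell d, F (k +ᵥ ω) x) ^ 2 ∂P := by
              refine lintegral_congr_ae ?_
              filter_upwards [hs k] with ω hω
              rw [lintegral_cell_of_stationary hω]
          _ = _ := by
              refine (measurePreserving_vadd k P).lintegral_comp
                (f := fun ω => (∫⁻ x in unitCell d, F ω x) ^ 2) ?_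
              have := hN 0
              rw [cell_zero] at this
              fun_prop
    _ = _ := by
        rw [ENNReal.tsum_mul_right, ← lintegral_eq_tsum_cell (fun y => κ' (x - y)),
          lintegral_sub_left_eq_self]
        ring

end

end StationaryCoulomb

/-! ### Pointwise estimates for the heat kernel and its Taylor remainder. -/

namespace StationaryCoulomb

noncomputable section

variable {d : ℕ}

/-- The heat kernel `(4πt)^{-d/2} e^{-|z|²/4t}`. -/
def heatKernel (t : ℝ) (z : Space d) : ℝ :=
  (4 * Real.pi * t) ^ (-((d : ℝ) / 2)) * Real.exp (-(‖z‖ ^ 2 / (4 * t)))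

lemma measurable_heatKernel : Measurable fun p : ℝ × Space d => heatKernel p.1 p.2 := by
  unfold heatKernel; fun_prop

lemma heatKernel_pos {t : ℝ} (ht : 0 < t) (z : Space d) : 0 < heatKernel t z := by
  unfold heatKernel; positivity

lemma lintegral_heatKernel {t : ℝ} (ht : 0 < t) :
    ∫⁻ z : Space d, ENNReal.ofReal (heatKernel t z) = 1 := by
  have hi : Integrable (heatKernel (d := d) t) := (integrable_heat ht).const_mul _
  rw [← ofReal_integral_eq_lintegral_ofReal hi
    (ae_of_all _ fun z => (heatKernel_pos ht z).le)]
  unfold heatKernel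
  rw [integral_const_mul, integral_heat ht, ← Real.rpow_add (by positivity)]
  simp

lemma heatKernel_le {t : ℝ} (ht : 0 < t) (z : Space d) :
    heatKernel t z ≤ t ^ (-((d : ℝ) / 2)) := by
  unfold heatKernel
  calc _ ≤ (4 * Real.pi * t) ^ (-((d : ℝ) / 2)) * 1 := by
        gcongr
        rw [Real.exp_le_one_iff, neg_nonpos]; positivity
    _ ≤ _ := by
        rw [mul_one]
        refine Real.rpow_le_rpow_of_nonpos ht ?_ (by simp; positivity)
        have := Real.pi_gt_three
        nlinarith

/-- Comparison of Gaussians of different widths: a loss `a` in the exponent becomes a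
factor `e^a`. -/
lemma heatKernel_le_mul_heatKernel {t s a : ℝ} (ht : 0 < t) (hs : 0 < s) {z z' : Space d}
    (h : ‖z'‖ ^ 2 / (4 * s) ≤ ‖z‖ ^ 2 / (4 * t) + a) :
    heatKernel t z ≤ ((s / t) ^ ((d : ℝ) / 2) * Real.exp a) * heatKernel s z' := by
  unfold heatKernel
  have e : (4 * Real.pi * t) ^ (-((d : ℝ) / 2)) =
      (s / t) ^ ((d : ℝ) / 2) * (4 * Real.pi * s) ^ (-((d : ℝ) / 2)) := by
    rw [Real.rpow_neg (by positivity), Real.rpow_neg (by positivity),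
      Real.div_rpow hs.le ht.le, Real.mul_rpow (by positivity) ht.le,
      Real.mul_rpow (by positivity) hs.le]
    field_simp
  rw [e]
  calc _ ≤ (s / t) ^ ((d : ℝ) / 2) * (4 * Real.pi * s) ^ (-((d : ℝ) / 2)) *
        Real.exp (a + -(‖z'‖ ^ 2 / (4 * s))) := by
        gcongr
        linarith
    _ = _ := by rw [Real.exp_add]; ring

lemma norm_sq_le_two_mul (z w : Space d) : ‖z‖ ^ 2 ≤ 2 * ‖z + w‖ ^ 2 + 2 * ‖w‖ ^ 2 := by
  have h : ‖z‖ ≤ ‖z + w‖ + ‖w‖ := by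
    have := norm_sub_le (z + w) w
    rwa [add_sub_cancel_right] at this
  nlinarith [norm_nonneg z, norm_nonneg (z + w), norm_nonneg w, sq_nonneg (‖z + w‖ - ‖w‖)]

/-- A cell has diameter at most `√d`, which is at most of the order of the length scale `√t` when `t
≥ 1`: moving `y` inside its cell is paid for by doubling the time, with a loss of at most `d / 4` in
the exponent. -/
lemma heatKernel_le_of_mem_cell {t : ℝ} (ht : 1 ≤ t) {k : Fin d → ℤ} (x : Space d)
    {y y' : Space d} (hy : y ∈ cell k) (hy' : y' ∈ cell k) :
    heatKernel t (x - y) ≤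
      (2 ^ ((d : ℝ) / 2) * Real.exp (d / 4)) * heatKernel (2 * t) (x - y') := by
  have ht0 : 0 < t := by linarith
  have h1 := norm_sub_sq_le_of_mem_cell hy' hy
  have h2 := norm_sq_le_two_mul (x - y') (y' - y)
  rw [sub_add_sub_cancel] at h2
  have h := heatKernel_le_mul_heatKernel (a := d / 4) ht0 (by positivity : 0 < 2 * t)
    (z := x - y) (z' := x - y') ?_
  · rwa [mul_div_cancel_right₀ _ ht0.ne'] at h
  · rw [div_le_iff₀ (by positivity)]
    have : (‖x - y‖ ^ 2 / (4 * t) + d / 4) * (4 * (2 * t)) = 2 * ‖x - y‖ ^ 2 + 2 * d * t := by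
      field_simp
    rw [this]
    have : (d : ℝ) ≤ d * t := le_mul_of_one_le_right (by positivity) ht
    linarith

/-- Away from the origin the Gaussian at time `t ≤ 1` carries a spare factor `e^{-1/(8t)}` compared
with the Gaussian at time `2`, and this factor beats every negative power of `t`. -/
lemma exists_rpow_mul_heatKernel_le (d : ℕ) : ∃ C : ℝ, 0 ≤ C ∧ ∀ t : ℝ, 0 < t → t ≤ 1 →
    ∀ z : Space d, 1 ≤ ‖z‖ → t ^ (-(1 / 2) : ℝ) * heatKernel t z ≤ C * heatKernel 2 z := by
  refine ⟨8 ^ (d + 1) * (d + 1).factorial * 2 ^ ((d : ℝ) / 2), by positivity,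
    fun t ht ht1 z hz => ?_⟩
  have hz2 : 1 ≤ ‖z‖ ^ 2 := one_le_pow₀ hz
  have h := heatKernel_le_mul_heatKernel (a := -(1 / (8 * t))) ht (by norm_num : (0 : ℝ) < 2)
    (z := z) (z' := z) ?_
  · have h1 : t ^ (-(1 / 2) : ℝ) * (2 / t) ^ ((d : ℝ) / 2) ≤ (1 / t) ^ (d + 1) * 2 ^ ((d : ℝ) / 2) := by
      have h1t : 1 ≤ 1 / t := by rwa [le_div_iff₀ ht, one_mul]
      have : t ^ (-(1 / 2) : ℝ) * (2 / t) ^ ((d : ℝ) / 2) =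
          (1 / t) ^ ((1 / 2 : ℝ) + d / 2) * 2 ^ ((d : ℝ) / 2) := by
        rw [Real.rpow_add (by positivity), Real.rpow_neg ht.le, one_div t, Real.inv_rpow ht.le,
          div_eq_mul_inv 2 t, Real.mul_rpow (by positivity) (by positivity)]
        ring
      rw [this]
      gcongr
      rw [← Real.rpow_natCast]
      refine Real.rpow_le_rpow_of_exponent_le h1t ?_
      push_cast
      have : (0 : ℝ) ≤ d := by positivity
      linarith
    have h2 : (1 / t) ^ (d + 1) * Real.exp (-(1 / (8 * t))) ≤ 8 ^ (d + 1) * (d + 1).factorial := by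
      have h3 := Real.pow_div_factorial_le_exp (1 / (8 * t)) (by positivity) (d + 1)
      rw [Real.exp_neg, ← div_eq_mul_inv, div_le_iff₀ (Real.exp_pos _)]
      rw [div_le_iff₀ (by positivity)] at h3
      have : (1 / t) ^ (d + 1) = 8 ^ (d + 1) * (1 / (8 * t)) ^ (d + 1) := by
        rw [← mul_pow]; congr 1; field_simp
      rw [this, mul_assoc]
      gcongr
      linarith
    calc t ^ (-(1 / 2) : ℝ) * heatKernel t z
        ≤ t ^ (-(1 / 2) : ℝ) * ((2 / t) ^ ((d : ℝ) / 2) * Real.exp (-(1 / (8 * t))) *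
            heatKernel 2 z) := by gcongr
      _ = (t ^ (-(1 / 2) : ℝ) * (2 / t) ^ ((d : ℝ) / 2)) * Real.exp (-(1 / (8 * t))) *
            heatKernel 2 z := by ring
      _ ≤ ((1 / t) ^ (d + 1) * 2 ^ ((d : ℝ) / 2)) * Real.exp (-(1 / (8 * t))) *
            heatKernel 2 z := by
          have := (heatKernel_pos (d := d) (by norm_num : (0 : ℝ) < 2) z).le
          gcongr
      _ = ((1 / t) ^ (d + 1) * Real.exp (-(1 / (8 * t)))) * 2 ^ ((d : ℝ) / 2) *
            heatKernel 2 z := by ring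
      _ ≤ _ := by
          have := (heatKernel_pos (d := d) (by norm_num : (0 : ℝ) < 2) z).le
          gcongr
  · have e1 : ‖z‖ ^ 2 / (4 * t) + -(1 / (8 * t)) = (2 * ‖z‖ ^ 2 - 1) / (8 * t) := by
      field_simp; ring
    rw [e1, div_le_div_iff₀ (by positivity) (by positivity)]
    nlinarith

lemma exp_sub_one_sub_id_nonneg (u : ℝ) : 0 ≤ Real.exp u - 1 - u := by
  linarith [Real.add_one_le_exp u]

/-- The form `1 + e^u` of the bound suits the heat kernel: since `G_t(p) e^u = G_t(p + v)`, it
produces the kernel at the two points `p` and `p + v` only, with no intermediate point. -/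
lemma exp_sub_one_sub_id_le (u : ℝ) : Real.exp u - 1 - u ≤ u ^ 2 * (1 + Real.exp u) := by
  have h1 : Real.exp u - 1 ≤ u * Real.exp u := by
    have := Real.add_one_le_exp (-u)
    rw [Real.exp_neg] at this
    have h := mul_le_mul_of_nonneg_right this (Real.exp_pos u).le
    rw [inv_mul_cancel₀ (Real.exp_pos u).ne'] at h
    linarith
  have h2 := Real.add_one_le_exp u
  rcases le_total 0 u with hu | hu
  · nlinarith [mul_le_mul_of_nonneg_left h1 hu, sq_nonneg u]
  · nlinarith [mul_le_mul_of_nonneg_left h2 (neg_nonneg.2 hu), sq_nonneg u, Real.exp_pos u,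
      mul_nonneg (sq_nonneg u) (Real.exp_pos u).le]

/-- The first order Taylor remainder of the heat kernel at `p`, evaluated at `p + v`. -/
def heatRemainder (t : ℝ) (p v : Space d) : ℝ :=
  heatKernel t (p + v) - heatKernel t p * (1 - inner ℝ p v / (2 * t))

lemma heatKernel_add (t : ℝ) (p v : Space d) : heatKernel t (p + v) =
    heatKernel t p * Real.exp (-((2 * inner ℝ p v + ‖v‖ ^ 2) / (4 * t))) := by
  unfold heatKernel
  rw [mul_assoc (_ ^ _), ← Real.exp_add, norm_add_sq_real]
  congr 2
  ring

/-- A polynomial factor in front of the heat kernel is absorbed by multiplying the time by `4`. -/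
lemma add_mul_heatKernel_le {t A : ℝ} (ht : 1 ≤ t) {p v : Space d} (hv : ‖v‖ ^ 2 ≤ A) :
    (‖p‖ ^ 2 / t + 1) * heatKernel t p ≤
      (8 * (4 ^ ((d : ℝ) / 2) * Real.exp A)) * heatKernel (4 * t) (p + v) := by
  have ht0 : 0 < t := by linarith
  have hA : 0 ≤ A := (sq_nonneg _).trans hv
  -- Half of the Gaussian exponent `|p|² / (4t)` absorbs the polynomial; the other half absorbs the
  -- passage from `p` to `p + v`.
  have h1 : ‖p‖ ^ 2 / t + 1 ≤ 8 * Real.exp (‖p‖ ^ 2 / (8 * t)) := by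
    have := Real.add_one_le_exp (‖p‖ ^ 2 / (8 * t))
    have e : ‖p‖ ^ 2 / t = 8 * (‖p‖ ^ 2 / (8 * t)) := by field_simp
    rw [e]; linarith
  have h2 : Real.exp (‖p‖ ^ 2 / (8 * t)) * heatKernel t p ≤
      (4 ^ ((d : ℝ) / 2) * Real.exp A) * heatKernel (4 * t) (p + v) := by
    have h := heatKernel_le_mul_heatKernel (a := A - ‖p‖ ^ 2 / (8 * t)) ht0
      (by positivity : 0 < 4 * t) (z := p) (z' := p + v) ?_
    · rw [mul_div_cancel_right₀ _ ht0.ne', Real.exp_sub] at h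
      calc _ ≤ Real.exp (‖p‖ ^ 2 / (8 * t)) * (4 ^ ((d : ℝ) / 2) * (Real.exp A /
            Real.exp (‖p‖ ^ 2 / (8 * t))) * heatKernel (4 * t) (p + v)) := by gcongr
        _ = _ := by field_simp
    · have h3 := norm_sq_le_two_mul (p + v) (-v)
      rw [add_neg_cancel_right, norm_neg] at h3
      have e : ‖p‖ ^ 2 / (4 * t) + (A - ‖p‖ ^ 2 / (8 * t)) = (‖p‖ ^ 2 + A * (8 * t)) / (8 * t) := by
        field_simp; ring
      rw [e, div_le_div_iff₀ (by positivity) (by positivity)]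
      have : A ≤ A * t := le_mul_of_one_le_right hA ht
      nlinarith
  calc _ ≤ (8 * Real.exp (‖p‖ ^ 2 / (8 * t))) * heatKernel t p := by
        have := (heatKernel_pos ht0 p).le
        gcongr
    _ ≤ _ := by rw [mul_assoc, mul_assoc]; gcongr

/-- A second order remainder costs two derivatives of `G_t`, that is a factor `t⁻¹` up to a
polynomial in `|p| / √t`, which is absorbed by widening the Gaussian. The gain `t⁻¹` is what makes
the integral over large times converge at `m = 0`. -/
lemma exists_abs_heatRemainder_le (d : ℕ) : ∃ C : ℝ, 0 ≤ C ∧ ∀ t : ℝ, 1 ≤ t →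
    ∀ p v : Space d, ‖v‖ ^ 2 ≤ (d : ℝ) →
      |heatRemainder t p v| ≤ C * (t⁻¹ * heatKernel (4 * t) (p + v)) := by
  -- `A` is the dimension in its role of bound for `‖v‖ ^ 2`, kept opaque so that it stays separate
  -- from the `d` in the exponents.
  obtain ⟨A, hAd⟩ : ∃ A : ℝ, A = d := ⟨_, rfl⟩
  have hA : 0 ≤ A := by rw [hAd]; positivity
  set B : ℝ := 8 * (4 ^ ((d : ℝ) / 2) * Real.exp A) with hB
  have hB0 : 0 ≤ B := by positivity
  refine ⟨(A ^ 2 + A) * B + (2 * A + 3 * A ^ 2) * B + A * B, by positivity,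
    fun t ht p v hv => ?_⟩
  rw [← hAd] at hv
  have ht0 : 0 < t := by linarith
  set u : ℝ := -((2 * inner ℝ p v + ‖v‖ ^ 2) / (4 * t)) with hu
  set G := heatKernel (4 * t) (p + v) with hG
  have hG0 : 0 < G := heatKernel_pos (by positivity) _
  have hp0 := heatKernel_pos ht0 p
  have hpv0 := heatKernel_pos ht0 (p + v)
  -- The linear term `1 - ⟨p, v⟩ / (2t)` equals `1 + u + ‖v‖² / (4t)`, so the remainder is that of
  -- the exponential plus an explicit term of order `t⁻¹`.
  have e : heatRemainder t p v = heatKernel t p * (Real.exp u - 1 - u) -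
      heatKernel t p * (‖v‖ ^ 2 / (4 * t)) := by
    rw [heatRemainder, heatKernel_add, hu]
    field_simp
    ring
  have hi : (inner ℝ p v) ^ 2 ≤ ‖p‖ ^ 2 * A := by
    have := abs_real_inner_le_norm p v
    calc (inner ℝ p v) ^ 2 = |inner ℝ p v| ^ 2 := (sq_abs _).symm
      _ ≤ (‖p‖ * ‖v‖) ^ 2 := by gcongr
      _ = ‖p‖ ^ 2 * ‖v‖ ^ 2 := by ring
      _ ≤ _ := by gcongr
  have hut : u ^ 2 ≤ t⁻¹ * (A * (‖p‖ ^ 2 / t) + A ^ 2) := by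
    have e1 : u ^ 2 = (2 * inner ℝ p v + ‖v‖ ^ 2) ^ 2 / (16 * t ^ 2) := by
      rw [hu]; field_simp; norm_num
    have e2 : t⁻¹ * (A * (‖p‖ ^ 2 / t) + A ^ 2) = (A * ‖p‖ ^ 2 + A ^ 2 * t) / t ^ 2 := by
      field_simp
    rw [e1, e2, div_le_div_iff₀ (by positivity) (by positivity)]
    have h1 : (2 * inner ℝ p v + ‖v‖ ^ 2) ^ 2 ≤ 16 * (A * ‖p‖ ^ 2 + A ^ 2 * t) := by
      have : (‖v‖ ^ 2) ^ 2 ≤ A ^ 2 := by gcongr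
      have : A ^ 2 ≤ A ^ 2 * t := le_mul_of_one_le_right (by positivity) ht
      nlinarith [sq_nonneg (2 * inner ℝ p v - ‖v‖ ^ 2), mul_nonneg hA (sq_nonneg ‖p‖)]
    nlinarith [sq_nonneg t, mul_le_mul_of_nonneg_right h1 (sq_nonneg t)]
  have b1 : (‖p‖ ^ 2 / t + 1) * heatKernel t p ≤ B * G := add_mul_heatKernel_le ht hv
  -- The same absorption with base point `p + v` and zero displacement, for the term of
  -- `exp_sub_one_sub_id_le` containing `e^u`.
  have b2 : (‖p + v‖ ^ 2 / t + 1) * heatKernel t (p + v) ≤ B * G := by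
    have := add_mul_heatKernel_le (A := A) ht (p := p + v) (v := 0) (by simpa using hA)
    rwa [add_zero] at this
  have hpp : ‖p‖ ^ 2 / t ≤ 2 * (‖p + v‖ ^ 2 / t) + 2 * A := by
    have h3 := norm_sq_le_two_mul p v
    rw [div_le_iff₀ ht0]
    have e3 : (2 * (‖p + v‖ ^ 2 / t) + 2 * A) * t = 2 * ‖p + v‖ ^ 2 + 2 * (A * t) := by field_simp
    have : A ≤ A * t := le_mul_of_one_le_right hA ht
    rw [e3]; linarith
  have n1 : 0 ≤ ‖p‖ ^ 2 / t := by positivity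
  have n2 : 0 ≤ ‖p + v‖ ^ 2 / t := by positivity
  have c1 : heatKernel t p * u ^ 2 ≤ t⁻¹ * ((A ^ 2 + A) * (B * G)) := by
    calc _ ≤ heatKernel t p * (t⁻¹ * (A * (‖p‖ ^ 2 / t) + A ^ 2)) := by gcongr
      _ = t⁻¹ * ((A * (‖p‖ ^ 2 / t) + A ^ 2) * heatKernel t p) := by ring
      _ ≤ t⁻¹ * ((A ^ 2 + A) * ((‖p‖ ^ 2 / t + 1) * heatKernel t p)) := by
          rw [← mul_assoc (A ^ 2 + A)]
          gcongr
          nlinarith [mul_nonneg (sq_nonneg A) n1]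
      _ ≤ _ := by gcongr
  have c2 : heatKernel t (p + v) * u ^ 2 ≤ t⁻¹ * ((2 * A + 3 * A ^ 2) * (B * G)) := by
    calc _ ≤ heatKernel t (p + v) * (t⁻¹ * (A * (‖p‖ ^ 2 / t) + A ^ 2)) := by gcongr
      _ = t⁻¹ * ((A * (‖p‖ ^ 2 / t) + A ^ 2) * heatKernel t (p + v)) := by ring
      _ ≤ t⁻¹ * ((2 * A + 3 * A ^ 2) * ((‖p + v‖ ^ 2 / t + 1) * heatKernel t (p + v))) := by
          rw [← mul_assoc (2 * A + 3 * A ^ 2)]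
          gcongr
          nlinarith [mul_nonneg (sq_nonneg A) n2, mul_le_mul_of_nonneg_left hpp hA]
      _ ≤ _ := by gcongr
  have c3 : heatKernel t p * (‖v‖ ^ 2 / (4 * t)) ≤ t⁻¹ * (A * (B * G)) := by
    have h4 : ‖v‖ ^ 2 / (4 * t) ≤ t⁻¹ * A := by
      rw [div_le_iff₀ (by positivity)]
      have : t⁻¹ * A * (4 * t) = 4 * A := by field_simp
      rw [this]; linarith
    calc _ ≤ heatKernel t p * (t⁻¹ * A) := by gcongr
      _ = t⁻¹ * (A * (1 * heatKernel t p)) := by ring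
      _ ≤ t⁻¹ * (A * ((‖p‖ ^ 2 / t + 1) * heatKernel t p)) := by gcongr; linarith
      _ ≤ _ := by gcongr
  have m0 : 0 ≤ heatKernel t p * (Real.exp u - 1 - u) :=
    mul_nonneg hp0.le (exp_sub_one_sub_id_nonneg u)
  have m1 : heatKernel t p * (Real.exp u - 1 - u) ≤
      heatKernel t p * u ^ 2 + heatKernel t (p + v) * u ^ 2 := by
    calc _ ≤ heatKernel t p * (u ^ 2 * (1 + Real.exp u)) := by
          gcongr; exact exp_sub_one_sub_id_le u
      _ = _ := by rw [heatKernel_add t p v]; ring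
  have m2 : 0 ≤ heatKernel t p * (‖v‖ ^ 2 / (4 * t)) := by positivity
  have e4 : ((A ^ 2 + A) * B + (2 * A + 3 * A ^ 2) * B + A * B) * (t⁻¹ * G) =
      t⁻¹ * ((A ^ 2 + A) * (B * G)) + t⁻¹ * ((2 * A + 3 * A ^ 2) * (B * G)) +
        t⁻¹ * (A * (B * G)) := by ring
  have k1 : 0 ≤ t⁻¹ * ((A ^ 2 + A) * (B * G)) := by positivity
  have k2 : 0 ≤ t⁻¹ * ((2 * A + 3 * A ^ 2) * (B * G)) := by positivity
  have k3 : 0 ≤ t⁻¹ * (A * (B * G)) := by positivity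
  rw [e, e4, abs_le]
  constructor <;> linarith

end

end StationaryCoulomb

/-! ### Smoothing properties of the heat semigroup and double time integrals. -/

namespace StationaryCoulomb

noncomputable section

variable {d : ℕ}

lemma heatKernel_sub_comm (t : ℝ) (x y : Space d) : heatKernel t (x - y) = heatKernel t (y - x) := by
  unfold heatKernel; rw [norm_sub_rev]

lemma lintegral_heatKernel_sub {t : ℝ} (ht : 0 < t) (x : Space d) :
    ∫⁻ y : Space d, ENNReal.ofReal (heatKernel t (x - y)) = 1 := by
  rw [lintegral_sub_left_eq_self (fun z : Space d => ENNReal.ofReal (heatKernel t z)),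
    lintegral_heatKernel ht]

/-- The heat semigroup acting on nonnegative functions. -/
def heatAverage (t : ℝ) (h : Space d → ℝ≥0∞) (x : Space d) : ℝ≥0∞ :=
  ∫⁻ y, ENNReal.ofReal (heatKernel t (x - y)) * h y

lemma measurable_ofReal_heatKernel_sub :
    Measurable fun p : ℝ × Space d × Space d =>
      ENNReal.ofReal (heatKernel p.1 (p.2.1 - p.2.2)) :=
  (measurable_heatKernel.comp (f := fun p : ℝ × Space d × Space d => (p.1, p.2.1 - p.2.2))
    (by fun_prop)).ennreal_ofReal

lemma measurable_ofReal_heatKernel_sub_right (t : ℝ) (x : Space d) :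
    Measurable fun y : Space d => ENNReal.ofReal (heatKernel t (x - y)) :=
  measurable_ofReal_heatKernel_sub.comp (f := fun y : Space d => (t, x, y)) (by fun_prop)

lemma measurable_heatAverage {h : Space d → ℝ≥0∞} (hh : Measurable h) :
    Measurable fun p : ℝ × Space d => heatAverage p.1 h p.2 := by
  unfold heatAverage
  refine Measurable.lintegral_prod_right' (f := fun p : (ℝ × Space d) × Space d =>
    ENNReal.ofReal (heatKernel p.1.1 (p.1.2 - p.2)) * h p.2) ?_
  exact (measurable_ofReal_heatKernel_sub.comp
    (f := fun p : (ℝ × Space d) × Space d => (p.1.1, p.1.2, p.2)) (by fun_prop)).mul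
    (by fun_prop)

lemma heatAverage_le {t : ℝ} (ht : 0 < t) {h : Space d → ℝ≥0∞} {a : ℝ≥0∞} (hh : ∀ y, h y ≤ a)
    (x : Space d) : heatAverage t h x ≤ a := by
  calc heatAverage t h x ≤ ∫⁻ y, ENNReal.ofReal (heatKernel t (x - y)) * a :=
        lintegral_mono fun y => by gcongr; exact hh y
    _ = a := by
        rw [lintegral_mul_const _ (measurable_ofReal_heatKernel_sub_right t x),
          lintegral_heatKernel_sub ht, one_mul]

lemma heatAverage_rpow_le {t : ℝ} (ht : 0 < t) {q : ℝ} (hq : 1 ≤ q) {h : Space d → ℝ≥0∞}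
    (hh : Measurable h) (x : Space d) :
    heatAverage t h x ^ q ≤ heatAverage t (fun y => h y ^ q) x := by
  have := lintegral_mul_rpow_le volume hq
    (measurable_ofReal_heatKernel_sub_right t x).aemeasurable hh.aemeasurable
  rwa [lintegral_heatKernel_sub ht, ENNReal.one_rpow, one_mul] at this

lemma heatAverage_le_lintegral {t : ℝ} (ht : 0 < t) {h : Space d → ℝ≥0∞}
    (hh : Measurable h) (x : Space d) :
    heatAverage t h x ≤ ENNReal.ofReal t ^ (-((d : ℝ) / 2)) * ∫⁻ y, h y := by
  rw [← lintegral_const_mul _ hh]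
  refine lintegral_mono fun y => ?_
  simp only
  gcongr
  rw [ENNReal.ofReal_rpow_of_pos ht]
  exact ENNReal.ofReal_le_ofReal (heatKernel_le ht _)

lemma lintegral_heatAverage {t : ℝ} (ht : 0 < t) {h : Space d → ℝ≥0∞} (hh : Measurable h) :
    ∫⁻ x, heatAverage t h x = ∫⁻ y, h y := by
  unfold heatAverage
  rw [lintegral_lintegral_swap]
  · refine lintegral_congr fun y => ?_
    simp only [fun x => heatKernel_sub_comm t x y]
    rw [lintegral_mul_const _ (measurable_ofReal_heatKernel_sub_right t y),
      lintegral_heatKernel_sub ht, one_mul]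
  · exact ((measurable_ofReal_heatKernel_sub.comp
      (f := fun p : Space d × Space d => (t, p.1, p.2)) (by fun_prop)).mul
      (by fun_prop)).aemeasurable

/-- `L^q → L^∞` smoothing of the heat semigroup. -/
lemma heatAverage_le_lintegral_rpow {t : ℝ} (ht : 0 < t) {q : ℝ} (hq : 1 ≤ q)
    {h : Space d → ℝ≥0∞} (hh : Measurable h) (x : Space d) :
    heatAverage t h x ≤
      ENNReal.ofReal t ^ (-((d : ℝ) / (2 * q))) * (∫⁻ y, h y ^ q) ^ (1 / q) := by
  have hq0 : 0 < q := by linarith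
  have h1 := (heatAverage_rpow_le ht hq hh x).trans
    (heatAverage_le_lintegral ht (hh.pow_const q) x)
  refine ((ENNReal.le_rpow_inv_iff hq0).2 h1).trans (le_of_eq ?_)
  rw [ENNReal.mul_rpow_of_nonneg _ _ (by positivity), ← ENNReal.rpow_mul, one_div]
  congr 2
  field_simp

/-- The inner semigroup is a contraction of `L^q` by Jensen and conservation of mass, so the
smoothing can be taken entirely from the outer time `t`. In the application this is used when `t` is
the larger of the two times. -/
lemma heatAverage_heatAverage_le {t s : ℝ} (ht : 0 < t) (hs : 0 < s) {q : ℝ} (hq : 1 ≤ q)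
    {h : Space d → ℝ≥0∞} (hh : Measurable h) (x : Space d) :
    heatAverage t (heatAverage s h) x ≤
      ENNReal.ofReal t ^ (-((d : ℝ) / (2 * q))) * (∫⁻ y, h y ^ q) ^ (1 / q) := by
  have hm : Measurable (heatAverage s h) :=
    (measurable_heatAverage hh).comp (f := fun x => (s, x)) (by fun_prop)
  refine (heatAverage_le_lintegral_rpow ht hq hm x).trans ?_
  gcongr _ * ?_ ^ _
  calc ∫⁻ y, heatAverage s h y ^ q ≤ ∫⁻ y, heatAverage s (fun y => h y ^ q) y :=
        lintegral_mono fun y => heatAverage_rpow_le hs hq hh y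
    _ = _ := lintegral_heatAverage hs (hh.pow_const q)

lemma lintegral_rpow_neg_half {t : ℝ} (ht : 0 < t) :
    ∫⁻ s in Ioc 0 t, ENNReal.ofReal (s ^ (-(1 / 2) : ℝ)) =
      ENNReal.ofReal (2 * t ^ (1 / 2 : ℝ)) := by
  have hi : IntegrableOn (fun s : ℝ => s ^ (-(1 / 2) : ℝ)) (Ioc 0 t) := by
    rw [← intervalIntegrable_iff_integrableOn_Ioc_of_le ht.le]
    exact intervalIntegral.intervalIntegrable_rpow' (by norm_num)
  rw [← ofReal_integral_eq_lintegral_ofReal hi, ← intervalIntegral.integral_of_le ht.le,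
    integral_rpow (Or.inl (by norm_num))]
  · congr 1
    norm_num
    ring
  · filter_upwards [ae_restrict_mem measurableSet_Ioc] with s hs
    exact Real.rpow_nonneg hs.1.le _

/-- The product weight `(ts)^{-1/2}` integrates functions of `max t s` like Lebesgue measure. -/
lemma lintegral_lintegral_max_le {m : ℝ → ℝ≥0∞} (hm : Measurable m) :
    ∫⁻ t in Ioc (0 : ℝ) 1, ENNReal.ofReal (t ^ (-(1 / 2) : ℝ)) *
      ∫⁻ s in Ioc (0 : ℝ) 1, ENNReal.ofReal (s ^ (-(1 / 2) : ℝ)) * m (max t s) ≤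
    4 * ∫⁻ t in Ioc (0 : ℝ) 1, m t := by
  set w : ℝ → ℝ≥0∞ := fun t => ENNReal.ofReal (t ^ (-(1 / 2) : ℝ)) with hw
  have hwm : Measurable w := by fun_prop
  set μ : Measure ℝ := volume.restrict (Ioc 0 1) with hμ
  set I : ℝ → ℝ → ℝ≥0∞ := fun t s => (Iic t).indicator (fun _ => 1) s with hI
  have hIm : Measurable (Function.uncurry I) := by
    have : Function.uncurry I = ({p : ℝ × ℝ | p.2 ≤ p.1}).indicator fun _ => 1 := by
      ext ⟨t, s⟩
      simp [hI, indicator, Function.uncurry]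
    rw [this]
    exact measurable_const.indicator (measurableSet_le measurable_snd measurable_fst)
  -- On the region `s ≤ t` the inner integral `∫₀ᵗ s^{-1/2} ds = 2 t^{1/2}` cancels the weight
  -- `t^{-1/2}` and leaves the factor `2`; the region `t ≤ s` contributes the same amount by
  -- symmetry.
  have hA : ∫⁻ t, ∫⁻ s, w t * w s * (I t s * m t) ∂μ ∂μ ≤ 2 * ∫⁻ t, m t ∂μ := by
    rw [← lintegral_const_mul _ hm]
    refine setLIntegral_mono' measurableSet_Ioc fun t ht => ?_
    calc ∫⁻ s, w t * w s * (I t s * m t) ∂μ = w t * m t * ∫⁻ s, I t s * w s ∂μ := by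
          rw [← lintegral_const_mul]
          · refine lintegral_congr fun s => ?_
            ring
          · exact (hIm.comp (f := fun s => (t, s)) (by fun_prop)).mul hwm
      _ ≤ w t * m t * ENNReal.ofReal (2 * t ^ (1 / 2 : ℝ)) := by
          gcongr
          rw [← lintegral_rpow_neg_half ht.1]
          have : ∀ s, I t s * w s = (Iic t).indicator w s := by
            intro s; simp [hI, indicator]
          simp only [this]
          rw [lintegral_indicator measurableSet_Iic, hμ, Measure.restrict_restrict measurableSet_Iic]
          refine lintegral_mono_set ?_
          rintro s ⟨h1, h2⟩
          exact ⟨h2.1, h1⟩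
      _ = 2 * m t := by
          have : w t * ENNReal.ofReal (2 * t ^ (1 / 2 : ℝ)) = 2 := by
            have h0 := ht.1
            rw [hw, ← ENNReal.ofReal_mul (Real.rpow_nonneg ht.1.le _),
              mul_left_comm, ← Real.rpow_add ht.1]
            norm_num
          rw [mul_right_comm, this]
  have hmeas : Measurable (Function.uncurry fun t s => w t * w s * (I t s * m t)) := by
    exact ((hwm.comp measurable_fst).mul (hwm.comp measurable_snd)).mul
      (hIm.mul (hm.comp measurable_fst))
  have hB : ∫⁻ t, ∫⁻ s, w t * w s * (I s t * m s) ∂μ ∂μ ≤ 2 * ∫⁻ t, m t ∂μ := by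
    rw [lintegral_lintegral_swap]
    · simpa only [mul_comm (w _) (w _)] using hA
    · have := (hmeas.comp measurable_swap).aemeasurable (μ := μ.prod μ)
      refine this.congr (ae_of_all _ fun p => ?_)
      simp only [Function.comp, Prod.swap, Function.uncurry]
      ring
  calc ∫⁻ t, w t * ∫⁻ s, w s * m (max t s) ∂μ ∂μ
      ≤ ∫⁻ t, (∫⁻ s, w t * w s * (I t s * m t) ∂μ) + (∫⁻ s, w t * w s * (I s t * m s) ∂μ) ∂μ := by
        refine lintegral_mono fun t => ?_
        rw [← lintegral_const_mul _ (by fun_prop), ← lintegral_add_left]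
        · refine lintegral_mono fun s => ?_
          rcases le_total s t with h | h
          · refine le_trans (le_of_eq ?_) le_self_add
            simp [hI, h, mul_assoc]
          · refine le_trans (le_of_eq ?_) le_add_self
            simp [hI, h, mul_assoc]
        · exact hmeas.comp (f := fun s => (t, s)) (by fun_prop)
    _ ≤ 2 * ∫⁻ t, m t ∂μ + 2 * ∫⁻ t, m t ∂μ := by
        rw [lintegral_add_left]
        · gcongr
        · exact hmeas.lintegral_prod_right
    _ = _ := by rw [← add_mul]; norm_num

end

end StationaryCoulomb

/-! ### The Hardy–Littlewood–Sobolev inequality for the small-time kernel. -/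

namespace StationaryCoulomb

noncomputable section

variable {d : ℕ}

/-- The real interpolation inequality behind the Hardy–Littlewood–Sobolev inequality. The critical
case is `α * (2 - q) = 1`. -/
lemma exists_lintegral_min_le {α q : ℝ} (hq1 : 1 ≤ q) (hq2 : q ≤ 2)
    (h : α * (2 - q) < 1 ∨ (α * (2 - q) = 1 ∧ 1 < α)) :
    ∃ C : ℝ≥0∞, C ≠ ∞ ∧ ∀ a b : ℝ≥0∞,
      ∫⁻ t in Ioc (0 : ℝ) 1, min a (ENNReal.ofReal t ^ (-α) * b) ≤
        C * (a ^ (q - 1) * b ^ (2 - q)) := by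
  rcases h with h | ⟨h, hα1⟩
  -- Below the critical exponent the minimum is bounded by the geometric mean of its two entries
  -- with weights `q - 1` and `2 - q`, and the resulting power of `t` is integrable at `0`.
  · refine ⟨∫⁻ t in Ioc (0 : ℝ) 1, ENNReal.ofReal (t ^ (-(α * (2 - q)))), ?_, fun a b => ?_⟩
    · have hi : IntegrableOn (fun s : ℝ => s ^ (-(α * (2 - q)))) (Ioc 0 1) := by
        rw [← intervalIntegrable_iff_integrableOn_Ioc_of_le zero_le_one]
        exact intervalIntegral.intervalIntegrable_rpow' (by linarith)
      exact hi.lintegral_lt_top.ne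
    · rw [← lintegral_mul_const _ (by fun_prop)]
      refine setLIntegral_mono' measurableSet_Ioc fun t ht => ?_
      have e : ∀ x : ℝ≥0∞, x = x ^ (q - 1) * x ^ (2 - q) := by
        intro x
        rw [← ENNReal.rpow_add_of_nonneg _ _ (by linarith) (by linarith)]
        norm_num
      calc min a (ENNReal.ofReal t ^ (-α) * b)
          = min a (ENNReal.ofReal t ^ (-α) * b) ^ (q - 1) *
            min a (ENNReal.ofReal t ^ (-α) * b) ^ (2 - q) := e _
        _ ≤ a ^ (q - 1) * (ENNReal.ofReal t ^ (-α) * b) ^ (2 - q) := by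
            exact mul_le_mul' (ENNReal.rpow_le_rpow (min_le_left _ _) (by linarith))
              (ENNReal.rpow_le_rpow (min_le_right _ _) (by linarith))
        _ = _ := by
            rw [ENNReal.mul_rpow_of_nonneg _ _ (by linarith), ← ENNReal.rpow_mul,
              neg_mul, ENNReal.ofReal_rpow_of_pos ht.1]
            ring
  · have hα0 : 0 < α := by linarith
    have hq2' : 2 - q = 1 / α := by field_simp; linarith
    have hq1' : q - 1 = 1 - 1 / α := by linarith
    have hαi : 1 / α < 1 := by rw [div_lt_one hα0]; exact hα1
    refine ⟨ENNReal.ofReal (1 + 1 / (α - 1)), ENNReal.ofReal_ne_top, fun a b => ?_⟩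
    have hC : ENNReal.ofReal (1 + 1 / (α - 1)) ≠ 0 := by
      have : 0 < α - 1 := by linarith
      rw [Ne, ENNReal.ofReal_eq_zero, not_le]
      positivity
    rcases eq_or_ne a 0 with rfl | ha0
    · simp
    rcases eq_or_ne b 0 with rfl | hb0
    · simp
    have hpow : ∀ x : ℝ≥0∞, x ≠ 0 → ∀ r : ℝ, 0 < r → x ^ r ≠ 0 := fun x hx r hr => by
      simp [ENNReal.rpow_eq_zero_iff, hx, hr.le]
    have p1 : 0 < q - 1 := by rw [hq1']; linarith
    have p2 : 0 < 2 - q := by rw [hq2']; positivity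
    rcases eq_or_ne b ∞ with rfl | hb
    · rw [ENNReal.top_rpow_of_pos p2, ENNReal.mul_top (hpow a ha0 _ p1), ENNReal.mul_top hC]
      exact le_top
    rcases eq_or_ne a ∞ with rfl | ha
    · rw [ENNReal.top_rpow_of_pos p1, ENNReal.top_mul (hpow b hb0 _ p2), ENNReal.mul_top hC]
      exact le_top
    obtain ⟨A, hA, rfl⟩ : ∃ A : ℝ, 0 < A ∧ ENNReal.ofReal A = a :=
      ⟨a.toReal, ENNReal.toReal_pos ha0 ha, ENNReal.ofReal_toReal ha⟩
    obtain ⟨B, hB, rfl⟩ : ∃ B : ℝ, 0 < B ∧ ENNReal.ofReal B = b :=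
      ⟨b.toReal, ENNReal.toReal_pos hb0 hb, ENNReal.ofReal_toReal hb⟩
    -- In the critical case that power is `t⁻¹`. The integral is instead split at the time `T` where
    -- the two entries are equal; the tail converges because `α > 1`, and both pieces are multiples
    -- of `A T = A ^ (q - 1) * B ^ (2 - q)`.
    set T : ℝ := (B / A) ^ (1 / α) with hT
    have hT0 : 0 < T := by positivity
    have hsub : ∫⁻ t in Ioc (0 : ℝ) 1, min (ENNReal.ofReal A)
        (ENNReal.ofReal t ^ (-α) * ENNReal.ofReal B) ≤
        (∫⁻ _ in Ioc (0 : ℝ) T, ENNReal.ofReal A) +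
          ∫⁻ t in Ioi T, ENNReal.ofReal (t ^ (-α) * B) := by
      calc _ ≤ ∫⁻ t in Ioc (0 : ℝ) T ∪ Ioi T, min (ENNReal.ofReal A)
            (ENNReal.ofReal t ^ (-α) * ENNReal.ofReal B) := by
            refine lintegral_mono_set ?_
            rw [Ioc_union_Ioi_eq_Ioi hT0.le]
            exact Ioc_subset_Ioi_self
        _ ≤ _ := lintegral_union_le _ _ _
        _ ≤ _ := by
            gcongr ?_ + ?_
            · exact lintegral_mono fun t => min_le_left _ _
            · refine setLIntegral_mono' measurableSet_Ioi fun t ht => ?_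
              have ht0 : 0 < t := hT0.trans ht
              refine (min_le_right _ _).trans (le_of_eq ?_)
              rw [ENNReal.ofReal_rpow_of_pos ht0, ENNReal.ofReal_mul (by positivity)]
    refine hsub.trans (le_of_eq ?_)
    have hint : IntegrableOn (fun t : ℝ => t ^ (-α) * B) (Ioi T) :=
      (integrableOn_Ioi_rpow_of_lt (by linarith) hT0).mul_const _
    rw [← ofReal_integral_eq_lintegral_ofReal hint, integral_mul_const,
      integral_Ioi_rpow_of_lt (by linarith) hT0, lintegral_const, Measure.restrict_apply_univ,
      Real.volume_Ioc, sub_zero, ← ENNReal.ofReal_mul hA.le,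
      ENNReal.ofReal_rpow_of_pos hA, ENNReal.ofReal_rpow_of_pos hB,
      ← ENNReal.ofReal_mul (by positivity), ← ENNReal.ofReal_mul, ← ENNReal.ofReal_add]
    · congr 1
      have e1 : A * T = A ^ (q - 1) * B ^ (2 - q) := by
        rw [hq1', hq2', Real.rpow_sub hA, Real.rpow_one, hT, Real.div_rpow hB.le hA.le]
        field_simp
      have e2 : T ^ (-α + 1) * B = A * T := by
        rw [Real.rpow_add hT0, Real.rpow_one, Real.rpow_neg hT0.le, hT, ← Real.rpow_mul (by positivity),
          one_div_mul_cancel hα0.ne', Real.rpow_one]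
        field_simp
      have : α - 1 ≠ 0 := by linarith
      have h3 : -α + 1 = -(α - 1) := by ring
      rw [← e1]
      calc A * T + -T ^ (-α + 1) / (-α + 1) * B = A * T + (T ^ (-α + 1) * B) / (α - 1) := by
            rw [h3]; field_simp
        _ = _ := by rw [e2]; field_simp
    · positivity
    · rw [show -α + 1 = -(α - 1) by ring, neg_div_neg_eq]
      have : 0 < α - 1 := by linarith
      positivity
    · have : 0 < α - 1 := by linarith
      positivity
    · filter_upwards [ae_restrict_mem measurableSet_Ioi] with t ht
      have : 0 < t := hT0.trans ht
      positivity

/-- The part of the kernel coming from small times. -/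
def smallKernel (z : Space d) : ℝ≥0∞ :=
  ∫⁻ t in Ioc (0 : ℝ) 1, ENNReal.ofReal (t ^ (-(1 / 2) : ℝ)) * ENNReal.ofReal (heatKernel t z)

lemma measurable_smallKernel : Measurable (smallKernel (d := d)) := by
  unfold smallKernel
  refine Measurable.lintegral_prod_right' (f := fun p : Space d × ℝ =>
    ENNReal.ofReal (p.2 ^ (-(1 / 2) : ℝ)) * ENNReal.ofReal (heatKernel p.2 p.1)) ?_
  exact (by fun_prop : Measurable fun p : Space d × ℝ =>
    ENNReal.ofReal (p.2 ^ (-(1 / 2) : ℝ))).mul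
    (measurable_heatKernel.comp measurable_swap).ennreal_ofReal

lemma smallKernel_sub_comm (x y : Space d) : smallKernel (x - y) = smallKernel (y - x) := by
  unfold smallKernel
  simp only [heatKernel_sub_comm _ x y]

lemma lintegral_smallKernel_mul {h : Space d → ℝ≥0∞} (hh : Measurable h) (x : Space d) :
    ∫⁻ y, smallKernel (x - y) * h y =
      ∫⁻ t in Ioc (0 : ℝ) 1, ENNReal.ofReal (t ^ (-(1 / 2) : ℝ)) * heatAverage t h x := by
  have hm : Measurable fun p : Space d × ℝ => ENNReal.ofReal (p.2 ^ (-(1 / 2) : ℝ)) *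
      ENNReal.ofReal (heatKernel p.2 (x - p.1)) :=
    (by fun_prop : Measurable fun p : Space d × ℝ => ENNReal.ofReal (p.2 ^ (-(1 / 2) : ℝ))).mul
      (measurable_ofReal_heatKernel_sub.comp (f := fun p : Space d × ℝ => (p.2, x, p.1))
        (by fun_prop))
  calc ∫⁻ y, smallKernel (x - y) * h y
      = ∫⁻ y, ∫⁻ t in Ioc (0 : ℝ) 1, ENNReal.ofReal (t ^ (-(1 / 2) : ℝ)) *
        ENNReal.ofReal (heatKernel t (x - y)) * h y := by
        refine lintegral_congr fun y => ?_
        rw [smallKernel, lintegral_mul_const]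
        exact hm.comp (f := fun t => (y, t)) (by fun_prop)
    _ = ∫⁻ t in Ioc (0 : ℝ) 1, ∫⁻ y, ENNReal.ofReal (t ^ (-(1 / 2) : ℝ)) *
        ENNReal.ofReal (heatKernel t (x - y)) * h y := by
        rw [lintegral_lintegral_swap]
        exact (hm.mul (by fun_prop)).aemeasurable
    _ = _ := by
        refine lintegral_congr fun t => ?_
        simp only [mul_assoc]
        rw [lintegral_const_mul _ ((measurable_ofReal_heatKernel_sub_right t x).fun_mul hh)]
        rfl

/-- Squaring a convolution with `smallKernel` and integrating leads to this iterated convolution,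
which the two time variables turn into a product of heat semigroups. -/
lemma lintegral_smallKernel_mul_smallKernel_mul {h : Space d → ℝ≥0∞} (hh : Measurable h)
    (y : Space d) :
    ∫⁻ x, smallKernel (y - x) * ∫⁻ z, smallKernel (x - z) * h z =
      ∫⁻ t in Ioc (0 : ℝ) 1, ENNReal.ofReal (t ^ (-(1 / 2) : ℝ)) *
        ∫⁻ s in Ioc (0 : ℝ) 1, ENNReal.ofReal (s ^ (-(1 / 2) : ℝ)) *
          heatAverage t (heatAverage s h) y := by
  simp only [lintegral_smallKernel_mul hh]
  have hm : Measurable fun p : Space d × ℝ =>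
      ENNReal.ofReal (p.2 ^ (-(1 / 2) : ℝ)) * heatAverage p.2 h p.1 :=
    (by fun_prop : Measurable fun p : Space d × ℝ => ENNReal.ofReal (p.2 ^ (-(1 / 2) : ℝ))).mul
      ((measurable_heatAverage hh).comp (f := fun p : Space d × ℝ => (p.2, p.1)) (by fun_prop))
  have hm' : Measurable fun x => ∫⁻ s in Ioc (0 : ℝ) 1,
      ENNReal.ofReal (s ^ (-(1 / 2) : ℝ)) * heatAverage s h x :=
    Measurable.lintegral_prod_right' (f := fun p : Space d × ℝ =>
      ENNReal.ofReal (p.2 ^ (-(1 / 2) : ℝ)) * heatAverage p.2 h p.1) hm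
  rw [lintegral_smallKernel_mul hm' y]
  refine lintegral_congr fun t => ?_
  congr 1
  have hk := measurable_ofReal_heatKernel_sub_right t y
  calc _ = ∫⁻ x, ∫⁻ s in Ioc (0 : ℝ) 1, ENNReal.ofReal (heatKernel t (y - x)) *
        (ENNReal.ofReal (s ^ (-(1 / 2) : ℝ)) * heatAverage s h x) := by
        refine lintegral_congr fun x => ?_
        rw [lintegral_const_mul]
        exact hm.comp (f := fun s => (x, s)) (by fun_prop)
    _ = ∫⁻ s in Ioc (0 : ℝ) 1, ∫⁻ x, ENNReal.ofReal (heatKernel t (y - x)) *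
        (ENNReal.ofReal (s ^ (-(1 / 2) : ℝ)) * heatAverage s h x) := by
        rw [lintegral_lintegral_swap]
        exact ((hk.comp measurable_fst).mul hm).aemeasurable
    _ = _ := by
        refine lintegral_congr fun s => ?_
        rw [heatAverage, ← lintegral_const_mul]
        · refine lintegral_congr fun x => ?_
          rw [mul_left_comm]
        · exact hk.mul ((measurable_heatAverage hh).comp (f := fun x => (s, x)) (by fun_prop))

/-- The Hardy–Littlewood–Sobolev type inequality `‖smallKernel * F‖_2 ≤ C ‖F‖_q`. -/
theorem exists_lintegral_smallKernel_sq_le {q : ℝ} (hq1 : 1 ≤ q) (hq2 : q ≤ 2)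
    (h : (d : ℝ) / (2 * q) * (2 - q) < 1 ∨
      ((d : ℝ) / (2 * q) * (2 - q) = 1 ∧ 1 < (d : ℝ) / (2 * q))) :
    ∃ C : ℝ≥0∞, C ≠ ∞ ∧ ∀ F : Space d → ℝ≥0∞, Measurable F →
      ∫⁻ x, (∫⁻ y, smallKernel (x - y) * F y) ^ 2 ≤ C * (∫⁻ y, F y ^ q) ^ (2 / q) := by
  obtain ⟨C, hC, hmin⟩ := exists_lintegral_min_le hq1 hq2 h
  refine ⟨2 * (4 * C), by finiteness, fun F hF => ?_⟩
  have hq0 : 0 < q := by linarith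
  set α : ℝ := (d : ℝ) / (2 * q) with hα
  have hα0 : 0 ≤ α := by positivity
  set b : ℝ≥0∞ := (∫⁻ y, F y ^ q) ^ (1 / q) with hb
  -- For each `y`, `Fa y` keeps only the values of `F` not exceeding `F y`. It is bounded by `F y`
  -- everywhere and its `L^q` norm is at most that of `F`: these are the two entries of the minimum
  -- in `exists_lintegral_min_le`.
  set Fa : Space d → Space d → ℝ≥0∞ := fun y z => {z | F z ≤ F y}.indicator F z with hFa
  have hFm : Measurable (Function.uncurry Fa) := by
    have : Function.uncurry Fa = {p : Space d × Space d | F p.2 ≤ F p.1}.indicator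
        (fun p => F p.2) := by
      ext ⟨y, z⟩
      simp [hFa, indicator, Function.uncurry]
    rw [this]
    exact (hF.comp measurable_snd).indicator
      (measurableSet_le (hF.comp measurable_snd) (hF.comp measurable_fst))
  have hFm' : ∀ y, Measurable (Fa y) := fun y => hFm.comp (f := fun z => (y, z)) (by fun_prop)
  have hFa1 : ∀ y z, Fa y z ≤ F y := fun y z => by
    simp only [hFa, indicator]
    split_ifs with hz
    · exact hz
    · exact zero_le
  have hFa2 : ∀ y z, Fa y z ≤ F z := fun y z => indicator_le_self _ _ _
  have hV : ∀ y, ∫⁻ x, smallKernel (y - x) * ∫⁻ z, smallKernel (x - z) * Fa y z ≤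
      4 * C * (F y ^ (q - 1) * b ^ (2 - q)) := by
    intro y
    rw [lintegral_smallKernel_mul_smallKernel_mul (hFm' y)]
    have hb1 : (∫⁻ z, Fa y z ^ q) ^ (1 / q) ≤ b := by
      rw [hb]
      gcongr
      exact hFa2 y _
    calc _ ≤ ∫⁻ t in Ioc (0 : ℝ) 1, ENNReal.ofReal (t ^ (-(1 / 2) : ℝ)) *
          ∫⁻ s in Ioc (0 : ℝ) 1, ENNReal.ofReal (s ^ (-(1 / 2) : ℝ)) *
          min (F y) (ENNReal.ofReal (max t s) ^ (-α) * b) := by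
          refine setLIntegral_mono' measurableSet_Ioc fun t ht => ?_
          gcongr _ * ?_
          refine setLIntegral_mono' measurableSet_Ioc fun s hs => ?_
          gcongr _ * ?_
          refine le_min ?_ ?_
          · exact heatAverage_le ht.1 (heatAverage_le hs.1 (hFa1 y)) y
          -- The `L^q → L^∞` smoothing is taken from the larger of the two times; at the other time
          -- the semigroup only has to contract `L^q` or `L^∞`.
          · rcases le_total s t with hst | hst
            · rw [max_eq_left hst]
              exact (heatAverage_heatAverage_le ht.1 hs.1 hq1 (hFm' y) y).trans (by gcongr)
            · rw [max_eq_right hst]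
              exact (heatAverage_le ht.1
                (heatAverage_le_lintegral_rpow hs.1 hq1 (hFm' y)) y).trans (by gcongr)
      _ ≤ 4 * ∫⁻ t in Ioc (0 : ℝ) 1, min (F y) (ENNReal.ofReal t ^ (-α) * b) :=
          lintegral_lintegral_max_le (m := fun t => min (F y) (ENNReal.ofReal t ^ (-α) * b))
            (by fun_prop)
      _ ≤ 4 * (C * (F y ^ (q - 1) * b ^ (2 - q))) := by gcongr; exact hmin _ _
      _ = _ := by ring
  have hS := measurable_smallKernel (d := d)
  -- The square is a double integral over `(y, z)`. It is symmetric, so it is at most twice its part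
  -- over `F z ≤ F y`, where `F z` may be replaced by `Fa y z`.
  have hpt : ∀ x, (∫⁻ y, smallKernel (x - y) * F y) ^ 2 ≤
      2 * ∫⁻ y, F y * (smallKernel (y - x) * ∫⁻ z, smallKernel (x - z) * Fa y z) := by
    intro x
    set k : Space d → ℝ≥0∞ := fun y => smallKernel (x - y) with hk
    have hkm : Measurable k := by fun_prop
    have hm3 : Measurable (Function.uncurry fun y z => k y * F y * (k z * Fa y z)) :=
      (((hkm.comp measurable_fst).mul (hF.comp measurable_fst)).mul
        ((hkm.comp measurable_snd).mul hFm))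
    have hA : ∫⁻ y, ∫⁻ z, k y * F y * (k z * Fa y z) =
        ∫⁻ y, F y * (smallKernel (y - x) * ∫⁻ z, smallKernel (x - z) * Fa y z) := by
      refine lintegral_congr fun y => ?_
      rw [lintegral_const_mul _ (hkm.fun_mul (hFm' y)), smallKernel_sub_comm y x]
      ring
    calc (∫⁻ y, k y * F y) ^ 2 = ∫⁻ y, ∫⁻ z, (k y * F y) * (k z * F z) := by
          have : ∀ y, ∫⁻ z, (k y * F y) * (k z * F z) = k y * F y * ∫⁻ z, k z * F z :=
            fun y => lintegral_const_mul _ (hkm.fun_mul hF)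
          simp only [this]
          rw [lintegral_mul_const _ (hkm.fun_mul hF), sq]
      _ ≤ ∫⁻ y, ((∫⁻ z, k y * F y * (k z * Fa y z)) + ∫⁻ z, k z * F z * (k y * Fa z y)) := by
          refine lintegral_mono fun y => ?_
          have hm3y : Measurable fun z => k y * F y * (k z * Fa y z) :=
            hm3.comp (f := fun z => (y, z)) (by fun_prop)
          rw [← lintegral_add_left hm3y]
          refine lintegral_mono fun z => ?_
          rcases le_total (F z) (F y) with hzy | hzy
          · refine le_trans (le_of_eq ?_) le_self_add
            simp [hFa, hzy]
          · refine le_trans (le_of_eq ?_) le_add_self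
            simp [hFa, hzy]
            ring
      _ = (∫⁻ y, ∫⁻ z, k y * F y * (k z * Fa y z)) +
          ∫⁻ y, ∫⁻ z, k z * F z * (k y * Fa z y) := lintegral_add_left hm3.lintegral_prod_right _
      _ = (∫⁻ y, ∫⁻ z, k y * F y * (k z * Fa y z)) +
          ∫⁻ y, ∫⁻ z, k y * F y * (k z * Fa y z) := by
          congr 1
          exact lintegral_lintegral_swap (hm3.comp measurable_swap).aemeasurable
      _ = _ := by rw [hA, two_mul]
  have hm4 : Measurable fun p : Space d × Space d =>
      smallKernel (p.2 - p.1) * ∫⁻ z, smallKernel (p.1 - z) * Fa p.2 z := by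
    refine Measurable.mul (by fun_prop) ?_
    refine Measurable.lintegral_prod_right' (f := fun p : (Space d × Space d) × Space d =>
      smallKernel (p.1.1 - p.2) * Fa p.1.2 p.2) ?_
    exact Measurable.mul (by fun_prop)
      (hFm.comp (f := fun p : (Space d × Space d) × Space d => (p.1.2, p.2)) (by fun_prop))
  calc ∫⁻ x, (∫⁻ y, smallKernel (x - y) * F y) ^ 2
      ≤ ∫⁻ x, 2 * ∫⁻ y, F y * (smallKernel (y - x) * ∫⁻ z, smallKernel (x - z) * Fa y z) :=
        lintegral_mono hpt
    _ = 2 * ∫⁻ x, ∫⁻ y, F y * (smallKernel (y - x) * ∫⁻ z, smallKernel (x - z) * Fa y z) :=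
        lintegral_const_mul' _ _ (by norm_num)
    _ = 2 * ∫⁻ y, F y * ∫⁻ x, (smallKernel (y - x) * ∫⁻ z, smallKernel (x - z) * Fa y z) := by
        rw [lintegral_lintegral_swap]
        · congr 1
          refine lintegral_congr fun y => ?_
          rw [lintegral_const_mul]
          exact hm4.comp (f := fun x => (x, y)) (by fun_prop)
        · exact ((hF.comp measurable_snd).mul hm4).aemeasurable
    _ ≤ 2 * ∫⁻ y, F y * (4 * C * (F y ^ (q - 1) * b ^ (2 - q))) := by
        gcongr with y
        exact hV y
    _ = 2 * ∫⁻ y, (4 * C * b ^ (2 - q)) * F y ^ q := by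
        congr 1
        refine lintegral_congr fun y => ?_
        -- The factor `F y ^ (q - 1)` from the interpolation joins the outer `F y`; the integral is
        -- then `b ^ q`, and `b ^ (2 - q) * b ^ q = b ^ 2` closes the estimate without Marcinkiewicz
        -- interpolation.
        have : F y ^ q = F y * F y ^ (q - 1) := by
          conv_rhs => enter [1]; rw [← ENNReal.rpow_one (F y)]
          rw [← ENNReal.rpow_add_of_nonneg _ _ zero_le_one (by linarith)]
          norm_num
        rw [this]; ring
    _ = 2 * (4 * C * (b ^ (2 - q) * b ^ q)) := by
        rw [lintegral_const_mul _ (by fun_prop)]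
        have : ∫⁻ y, F y ^ q = b ^ q := by
          rw [hb, ← ENNReal.rpow_mul, one_div_mul_cancel hq0.ne', ENNReal.rpow_one]
        rw [this]; ring
    _ = _ := by
        rw [← ENNReal.rpow_add_of_nonneg _ _ (by linarith) hq0.le, hb, ← ENNReal.rpow_mul]
        have : 1 / q * (2 - q + q) = 2 / q := by ring
        rw [this]; ring

end

end StationaryCoulomb

/-! ### The dominating kernel and the second moment of its convolution. -/

namespace StationaryCoulomb

noncomputable section

variable {d : ℕ}

/-- Superposition of the heat kernels at the times `c * t`, `t > 1`, with weight `t^{-3/2}`. -/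
def largeKernel (c : ℝ) (z : Space d) : ℝ≥0∞ :=
  ∫⁻ t in Ioi (1 : ℝ), ENNReal.ofReal (t ^ (-(3 / 2) : ℝ)) *
    ENNReal.ofReal (heatKernel (c * t) z)

lemma measurable_largeKernel_integrand (c : ℝ) : Measurable fun p : Space d × ℝ =>
    ENNReal.ofReal (p.2 ^ (-(3 / 2) : ℝ)) * ENNReal.ofReal (heatKernel (c * p.2) p.1) :=
  (by fun_prop : Measurable fun p : Space d × ℝ => ENNReal.ofReal (p.2 ^ (-(3 / 2) : ℝ))).mul
    (measurable_heatKernel.comp (f := fun p : Space d × ℝ => (c * p.2, p.1))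
      (by fun_prop)).ennreal_ofReal

lemma measurable_largeKernel (c : ℝ) : Measurable (largeKernel (d := d) c) :=
  (measurable_largeKernel_integrand c).lintegral_prod_right'

lemma lintegral_largeKernel_ne_top {c : ℝ} (hc : 0 < c) :
    ∫⁻ z, largeKernel (d := d) c z ≠ ∞ := by
  unfold largeKernel
  rw [lintegral_lintegral_swap (measurable_largeKernel_integrand c).aemeasurable]
  have : ∫⁻ t in Ioi (1 : ℝ), ∫⁻ z : Space d, ENNReal.ofReal (t ^ (-(3 / 2) : ℝ)) *
      ENNReal.ofReal (heatKernel (c * t) z) =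
      ∫⁻ t in Ioi (1 : ℝ), ENNReal.ofReal (t ^ (-(3 / 2) : ℝ)) := by
    refine setLIntegral_congr_fun measurableSet_Ioi fun t ht => ?_
    have ht0 : 0 < t := zero_lt_one.trans ht
    rw [lintegral_const_mul' _ _ ENNReal.ofReal_ne_top,
      lintegral_heatKernel (mul_pos hc ht0), mul_one]
  rw [this]
  exact (integrableOn_Ioi_rpow_of_lt (by norm_num) zero_lt_one).lintegral_lt_top.ne

lemma lintegral_smallKernel_ne_top : ∫⁻ z, smallKernel (d := d) z ≠ ∞ := by
  -- The mass of the kernel is its convolution with the constant `1` at the origin, where each heat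
  -- average is at most `1`; what is left is `∫₀¹ t^{-1/2} dt`.
  have h := lintegral_smallKernel_mul (d := d) (h := fun _ => 1) measurable_const 0
  simp only [mul_one, zero_sub] at h
  rw [lintegral_neg_eq_self (fun y : Space d => smallKernel y)] at h
  rw [h]
  refine ne_top_of_le_ne_top (b := ENNReal.ofReal (2 * 1 ^ (1 / 2 : ℝ))) ENNReal.ofReal_ne_top ?_
  rw [← lintegral_rpow_neg_half zero_lt_one]
  refine setLIntegral_mono' measurableSet_Ioc fun t ht => ?_
  calc _ ≤ ENNReal.ofReal (t ^ (-(1 / 2) : ℝ)) * 1 := by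
        gcongr
        exact heatAverage_le ht.1 (fun _ => le_rfl) _
    _ = _ := mul_one _

/-- The kernel dominating, after subtraction of the first order Taylor polynomials in the cells,
all the kernels `W_m`. -/
def majorant (z : Space d) : ℝ≥0∞ := smallKernel z + largeKernel 4 z

lemma measurable_majorant : Measurable (majorant (d := d)) :=
  measurable_smallKernel.add (measurable_largeKernel 4)

lemma lintegral_majorant_ne_top : ∫⁻ z, majorant (d := d) z ≠ ∞ := by
  unfold majorant
  rw [lintegral_add_left measurable_smallKernel]
  exact ENNReal.add_ne_top.2
    ⟨lintegral_smallKernel_ne_top, lintegral_largeKernel_ne_top (by norm_num)⟩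

lemma exists_smallKernel_le (d : ℕ) : ∃ C : ℝ, 0 ≤ C ∧ ∀ z : Space d, 1 ≤ ‖z‖ →
    smallKernel z ≤ ENNReal.ofReal (C * heatKernel 2 z) := by
  obtain ⟨C, hC, h⟩ := exists_rpow_mul_heatKernel_le d
  refine ⟨C, hC, fun z hz => ?_⟩
  calc smallKernel z ≤ ∫⁻ _ in Ioc (0 : ℝ) 1, ENNReal.ofReal (C * heatKernel 2 z) := by
        refine setLIntegral_mono' measurableSet_Ioc fun t ht => ?_
        rw [← ENNReal.ofReal_mul (Real.rpow_nonneg ht.1.le _)]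
        exact ENNReal.ofReal_le_ofReal (h t ht.1 ht.2 z hz)
    _ = _ := by simp

/-- Outside the unit ball both parts of `majorant` are bounded by Gaussians of time at least `2`,
and `largeKernel 4` is so everywhere. Such kernels satisfy the cell comparison of
`lintegral_lintegral_kernel_sq_le`; `κ'` is `κ` with every time doubled, which turns `largeKernel 4`
into `largeKernel 8`. -/
lemma exists_far_kernel (d : ℕ) : ∃ κ κ' : Space d → ℝ≥0∞, Measurable κ ∧
    ∫⁻ z, κ' z ≠ ∞ ∧
    (∀ z, 1 ≤ ‖z‖ → smallKernel z ≤ κ z) ∧ (∀ z, largeKernel 4 z ≤ κ z) ∧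
    ∀ (k : Fin d → ℤ) (x y y' : Space d), y ∈ cell k → y' ∈ cell k → κ (x - y) ≤ κ' (x - y') := by
  obtain ⟨C, hC, h⟩ := exists_smallKernel_le d
  set D : ℝ := 2 ^ ((d : ℝ) / 2) * Real.exp (d / 4) with hD
  have hD0 : 0 ≤ D := by positivity
  have hg : ∀ t : ℝ, Measurable fun z : Space d => ENNReal.ofReal (heatKernel t z) := fun t =>
    (measurable_heatKernel.comp (f := fun z : Space d => (t, z)) (by fun_prop)).ennreal_ofReal
  refine ⟨fun z => ENNReal.ofReal C * ENNReal.ofReal (heatKernel 2 z) + largeKernel 4 z,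
    fun z => ENNReal.ofReal D * (ENNReal.ofReal C * ENNReal.ofReal (heatKernel 4 z) +
      largeKernel 8 z), ?_, ?_, ?_, ?_, ?_⟩
  · exact ((hg 2).const_mul _).add (measurable_largeKernel 4)
  · rw [lintegral_const_mul' _ _ ENNReal.ofReal_ne_top, lintegral_add_left ((hg 4).const_mul _),
      lintegral_const_mul' _ _ ENNReal.ofReal_ne_top, lintegral_heatKernel (by norm_num)]
    have := lintegral_largeKernel_ne_top (d := d) (c := 8) (by norm_num)
    finiteness
  · intro z hz
    refine (h z hz).trans ?_
    rw [ENNReal.ofReal_mul hC]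
    exact le_self_add
  · exact fun z => le_add_self
  · intro k x y y' hy hy'
    have key : ∀ t : ℝ, 1 ≤ t → ENNReal.ofReal (heatKernel t (x - y)) ≤
        ENNReal.ofReal D * ENNReal.ofReal (heatKernel (2 * t) (x - y')) := by
      intro t ht
      rw [← ENNReal.ofReal_mul hD0]
      exact ENNReal.ofReal_le_ofReal (heatKernel_le_of_mem_cell ht x hy hy')
    simp only [mul_add]
    gcongr ?_ + ?_
    · rw [mul_left_comm]
      gcongr
      have := key 2 (by norm_num)
      norm_num at this
      exact this
    · unfold largeKernel
      rw [← lintegral_const_mul' _ _ ENNReal.ofReal_ne_top]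
      refine setLIntegral_mono' measurableSet_Ioi fun t ht => ?_
      have ht : 1 < t := ht
      have := key (4 * t) (by linarith)
      rw [mul_left_comm]
      gcongr
      rw [← mul_assoc] at this
      norm_num at this
      exact this

lemma add_sq_le_two_mul (a b : ℝ≥0∞) : (a + b) ^ 2 ≤ 2 * a ^ 2 + 2 * b ^ 2 := by
  have h := ENNReal.rpow_add_le_mul_rpow_add_rpow a b (p := 2) (by norm_num)
  norm_num at h
  rwa [mul_add] at h

lemma unitCell_subset_closedBall : unitCell d ⊆ Metric.closedBall 0 √d := by
  intro y hy
  rw [← cell_zero] at hy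
  have h := norm_sub_sq_le_of_mem_cell hy (latticePoint_mem_cell 0)
  have e : latticePoint (0 : Fin d → ℤ) = (0 : Space d) := by
    ext i; simp [latticePoint]
  rw [e, sub_zero] at h
  rw [mem_closedBall_zero_iff]
  exact Real.le_sqrt_of_sq_le h

lemma lintegral_unitCell_sq_le {q : ℝ} (hq1 : 1 ≤ q) {F : Space d → ℝ≥0∞} (hF : Measurable F) :
    (∫⁻ y in unitCell d, F y) ^ 2 ≤ (∫⁻ y in unitCell d, F y ^ q) ^ (2 / q) := by
  have hq0 : 0 < q := by linarith
  have h := lintegral_mul_rpow_le (volume.restrict (unitCell d)) hq1 (k := fun _ => 1)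
    aemeasurable_const hF.aemeasurable
  simp only [one_mul, lintegral_const, Measure.restrict_apply_univ, volume_unitCell,
    ENNReal.one_rpow] at h
  calc (∫⁻ y in unitCell d, F y) ^ 2 = ((∫⁻ y in unitCell d, F y) ^ q) ^ (2 / q) := by
        rw [← ENNReal.rpow_mul, mul_div_cancel₀ _ hq0.ne']
        norm_num
    _ ≤ _ := by gcongr

variable {Ω : Type*} [AddAction (Fin d → ℤ) Ω] [MeasurableSpace Ω]

/-- Only `smallKernel` near the origin is singular: there the local `L^q` norm of `F` is used
through the Hardy–Littlewood–Sobolev inequality. All the rest is bounded by `κ` and needs only the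
second moment of the mass of `F` in the unit cell. -/
theorem lintegral_lintegral_majorant_sq_lt_top (P : Measure Ω)
    [MeasurableConstVAdd (Fin d → ℤ) Ω] [VAddInvariantMeasure (Fin d → ℤ) Ω P]
    [SFinite P] {q : ℝ} (hq1 : 1 ≤ q) (hq2 : q ≤ 2)
    (h : (d : ℝ) / (2 * q) * (2 - q) < 1 ∨
      ((d : ℝ) / (2 * q) * (2 - q) = 1 ∧ 1 < (d : ℝ) / (2 * q)))
    {F : Ω → Space d → ℝ≥0∞} (hF : Measurable (Function.uncurry F))
    (hs : ∀ k : Fin d → ℤ, ∀ᵐ ω ∂P, ∀ᵐ x, F (k +ᵥ ω) x = F ω (latticePoint k + x))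
    (hfin : ∀ R : ℝ, ∫⁻ ω, (∫⁻ y in Metric.closedBall 0 R, F ω y ^ q) ^ (2 / q) ∂P < ∞)
    (ρ : ℝ) :
    ∫⁻ ω, (∫⁻ x in Metric.closedBall 0 ρ, (∫⁻ y, majorant (x - y) * F ω y) ^ 2) ∂P < ∞ := by
  obtain ⟨C, hC, hHLS⟩ := exists_lintegral_smallKernel_sq_le (d := d) hq1 hq2 h
  obtain ⟨κ, κ', hκ, hκ'fin, hsmall, hlarge, hcell⟩ := exists_far_kernel d
  have hq0 : 0 < q := by linarith
  -- The margin `1` ensures `‖x - y‖ ≥ 1` when `‖x‖ ≤ ρ` and `y ∉ B`, so that `smallKernel (x - y) ≤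
  -- κ (x - y)` there.
  set B : Set (Space d) := Metric.closedBall 0 (ρ + 1) with hB
  have hBm : MeasurableSet B := Metric.isClosed_closedBall.measurableSet
  have hFω : ∀ ω, Measurable (F ω) := fun ω => hF.comp (f := fun y => (ω, y)) (by fun_prop)
  have hpt : ∀ ω, ∀ x ∈ Metric.closedBall (0 : Space d) ρ,
      (∫⁻ y, majorant (x - y) * F ω y) ^ 2 ≤
        2 * (∫⁻ y, smallKernel (x - y) * B.indicator (F ω) y) ^ 2 +
          8 * (∫⁻ y, κ (x - y) * F ω y) ^ 2 := by
    intro ω x hx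
    -- The factor `2` is needed for `y ∉ B`, where `smallKernel` and `largeKernel 4` are each
    -- bounded by `κ`.
    have h1 : ∫⁻ y, majorant (x - y) * F ω y ≤
        (∫⁻ y, smallKernel (x - y) * B.indicator (F ω) y) + 2 * ∫⁻ y, κ (x - y) * F ω y := by
      rw [← lintegral_const_mul' _ _ (by norm_num), ← lintegral_add_left]
      · refine lintegral_mono fun y => ?_
        by_cases hy : y ∈ B
        · rw [indicator_of_mem hy, majorant, add_mul]
          refine add_le_add le_rfl ?_
          calc largeKernel 4 (x - y) * F ω y ≤ κ (x - y) * F ω y := by gcongr; exact hlarge _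
            _ ≤ 2 * (κ (x - y) * F ω y) := le_mul_of_one_le_left zero_le (by norm_num)
        · rw [indicator_of_notMem hy, mul_zero, zero_add, majorant, add_mul, two_mul]
          have hd : 1 ≤ ‖x - y‖ := by
            rw [mem_closedBall_zero_iff] at hx
            rw [hB, mem_closedBall_zero_iff, not_le] at hy
            have := norm_sub_norm_le y x
            rw [norm_sub_rev] at this
            linarith
          gcongr
          · exact hsmall _ hd
          · exact hlarge _
      · exact (measurable_smallKernel.comp (by fun_prop)).mul ((hFω ω).indicator hBm)
    calc _ ≤ ((∫⁻ y, smallKernel (x - y) * B.indicator (F ω) y) +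
          2 * ∫⁻ y, κ (x - y) * F ω y) ^ 2 := by gcongr
      _ ≤ _ := add_sq_le_two_mul _ _
      _ = _ := by ring
  have hmnear : Measurable fun p : Ω × Space d =>
      ∫⁻ y, smallKernel (p.2 - y) * B.indicator (F p.1) y := by
    refine Measurable.lintegral_prod_right' (f := fun p : (Ω × Space d) × Space d =>
      smallKernel (p.1.2 - p.2) * B.indicator (F p.1.1) p.2) ?_
    refine (measurable_smallKernel.comp (by fun_prop)).mul ?_
    have : (fun p : (Ω × Space d) × Space d => B.indicator (F p.1.1) p.2) =
        (Prod.snd ⁻¹' B).indicator fun p => Function.uncurry F (p.1.1, p.2) := by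
      ext p
      by_cases hp : p.2 ∈ B
      · rw [indicator_of_mem hp, indicator_of_mem (by exact hp)]; rfl
      · rw [indicator_of_notMem hp, indicator_of_notMem (by exact hp)]
    rw [this]
    exact (hF.comp (f := fun p : (Ω × Space d) × Space d => (p.1.1, p.2)) (by fun_prop)).indicator
      (measurable_snd hBm)
  have hmfar : Measurable fun p : Ω × Space d => ∫⁻ y, κ (p.2 - y) * F p.1 y := by
    refine Measurable.lintegral_prod_right' (f := fun p : (Ω × Space d) × Space d =>
      κ (p.1.2 - p.2) * F p.1.1 p.2) ?_
    exact (hκ.comp (by fun_prop)).mul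
      (hF.comp (f := fun p : (Ω × Space d) × Space d => (p.1.1, p.2)) (by fun_prop))
  have hnear : ∫⁻ ω, (∫⁻ x in Metric.closedBall 0 ρ,
      (∫⁻ y, smallKernel (x - y) * B.indicator (F ω) y) ^ 2) ∂P < ∞ := by
    calc _ ≤ ∫⁻ ω, C * (∫⁻ y in B, F ω y ^ q) ^ (2 / q) ∂P := by
          refine lintegral_mono fun ω => ?_
          refine (setLIntegral_le_lintegral _ _).trans ?_
          refine (hHLS _ ((hFω ω).indicator hBm)).trans (le_of_eq ?_)
          congr 2
          rw [← lintegral_indicator hBm]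
          refine lintegral_congr fun y => ?_
          by_cases hy : y ∈ B
          · simp [hy]
          · simp [hy, hq0]
      _ = C * ∫⁻ ω, (∫⁻ y in B, F ω y ^ q) ^ (2 / q) ∂P := lintegral_const_mul' _ _ hC
      _ < ∞ := ENNReal.mul_lt_top hC.lt_top (hfin _)
  have hN : ∫⁻ ω, (∫⁻ y in unitCell d, F ω y) ^ 2 ∂P < ∞ := by
    refine lt_of_le_of_lt (lintegral_mono fun ω => ?_) (hfin √d)
    refine (lintegral_unitCell_sq_le hq1 (hFω ω)).trans ?_
    gcongr
    exact unitCell_subset_closedBall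
  have hfar : ∫⁻ ω, (∫⁻ x in Metric.closedBall (0 : Space d) ρ,
      (∫⁻ y, κ (x - y) * F ω y) ^ 2) ∂P < ∞ := by
    rw [lintegral_lintegral_swap (hmfar.pow_const 2).aemeasurable]
    calc _ ≤ ∫⁻ _ in Metric.closedBall (0 : Space d) ρ,
          (∫⁻ z, κ' z) ^ 2 * ∫⁻ ω, (∫⁻ y in unitCell d, F ω y) ^ 2 ∂P :=
          lintegral_mono fun x => lintegral_lintegral_kernel_sq_le P hcell hF hs x
      _ < ∞ := by
          rw [lintegral_const, Measure.restrict_apply_univ]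
          have := (isCompact_closedBall (0 : Space d) ρ).measure_lt_top (μ := volume)
          finiteness
  calc _ ≤ ∫⁻ ω, (2 * (∫⁻ x in Metric.closedBall 0 ρ,
          (∫⁻ y, smallKernel (x - y) * B.indicator (F ω) y) ^ 2) +
          8 * ∫⁻ x in Metric.closedBall 0 ρ, (∫⁻ y, κ (x - y) * F ω y) ^ 2) ∂P := by
        refine lintegral_mono fun ω => ?_
        rw [← lintegral_const_mul' _ _ (by norm_num), ← lintegral_const_mul' _ _ (by norm_num),
          ← lintegral_add_left]
        · exact setLIntegral_mono' Metric.isClosed_closedBall.measurableSet fun x hx => hpt ω x hx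
        · exact ((hmnear.comp (f := fun x => (ω, x)) (by fun_prop)).pow_const 2).const_mul 2
    _ < ∞ := by
        rw [lintegral_add_left (((hmnear.pow_const 2).lintegral_prod_right').const_mul 2),
          lintegral_const_mul' _ _ (by norm_num), lintegral_const_mul' _ _ (by norm_num)]
        finiteness

end

end StationaryCoulomb

/-! ### The kernel `W_m` as a mixture of heat kernels, and the subtraction of affine functions in
the cells. -/

namespace StationaryCoulomb

noncomputable section

variable {d : ℕ}

/-- The weight of the heat kernel at time `t` in `W_m`. -/
def timeWeight (m t : ℝ) : ℝ := t ^ ((1 / 2 : ℝ) - 1) * Real.exp (-(m ^ 2 * t))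

lemma measurable_timeWeight (m : ℝ) : Measurable (timeWeight m) := by
  unfold timeWeight; fun_prop

lemma timeWeight_nonneg (m : ℝ) {t : ℝ} (ht : 0 < t) : 0 ≤ timeWeight m t := by
  unfold timeWeight; positivity

lemma timeWeight_le (m : ℝ) {t : ℝ} (ht : 0 < t) : timeWeight m t ≤ t ^ (-(1 / 2) : ℝ) := by
  unfold timeWeight
  norm_num
  refine mul_le_of_le_one_right (by positivity) ?_
  rw [Real.exp_le_one_iff, neg_nonpos]
  positivity

lemma heatMix_eq (m t : ℝ) (z : Space d) : heatMix m (z, t) = timeWeight m t * heatKernel t z := rfl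

/-- A representative of `W_m`. -/
def explicitKernel (m : ℝ) (z : Space d) : ℝ :=
  (√(sphereArea d) / √Real.pi) * ∫ t in Ioi 0, heatMix m (z, t)

lemma integral_heatMix_fourier {m : ℝ} (hm : 0 < m) (K : Space d) :
    ∫ x : Space d, ((∫ t in Ioi 0, heatMix m (x, t) : ℝ) : ℂ) *
      Complex.exp (-(Complex.I * (inner ℝ K x : ℝ))) =
      ((√Real.pi / √(m ^ 2 + ‖K‖ ^ 2) : ℝ) : ℂ) := by
  have hint : Integrable (fun p : Space d × ℝ => ((heatMix m p : ℝ) : ℂ) *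
      Complex.exp (-(Complex.I * (inner ℝ K p.1 : ℝ))))
      ((volume : Measure (Space d)).prod ((volume : Measure ℝ).restrict (Ioi 0))) := by
    refine (integrable_heatMix hm).ofReal.mul_bdd (c := 1) ?_ (ae_of_all _ fun p => ?_)
    · exact (by fun_prop : Continuous fun p : Space d × ℝ =>
        Complex.exp (-(Complex.I * (inner ℝ K p.1 : ℝ)))).aestronglyMeasurable
    · rw [show -(Complex.I * ((inner ℝ K p.1 : ℝ) : ℂ)) =
        ((-(inner ℝ K p.1 : ℝ) : ℝ) : ℂ) * Complex.I by push_cast; ring,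
        Complex.norm_exp_ofReal_mul_I]
  calc _ = ∫ x : Space d, ∫ t in Ioi (0 : ℝ), ((heatMix m (x, t) : ℝ) : ℂ) *
        Complex.exp (-(Complex.I * (inner ℝ K x : ℝ))) := by
        refine integral_congr_ae (ae_of_all _ fun x => ?_)
        simp only
        rw [integral_mul_const, integral_complex_ofReal]
    _ = ∫ t in Ioi (0 : ℝ), ∫ x : Space d, ((heatMix m (x, t) : ℝ) : ℂ) *
        Complex.exp (-(Complex.I * (inner ℝ K x : ℝ))) := integral_integral_swap hint
    _ = ∫ t in Ioi (0 : ℝ), ((t ^ ((1 / 2 : ℝ) - 1) *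
        Real.exp (-((m ^ 2 + ‖K‖ ^ 2) * t)) : ℝ) : ℂ) := by
        refine setIntegral_congr_fun measurableSet_Ioi fun t ht => ?_
        have ht : 0 < t := ht
        simp only [heatMix, Complex.ofReal_mul, mul_assoc]
        rw [integral_const_mul, integral_const_mul, integral_const_mul,
          integral_heat_fourier ht K]
        simp only [← Complex.ofReal_mul]
        congr 1
        have h1 : (4 * (Real.pi * t)) ^ (-((d : ℝ) / 2)) *
            (4 * Real.pi * t) ^ ((d : ℝ) / 2) = 1 := by
          rw [← mul_assoc, ← Real.rpow_add (by positivity)]; simp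
        rw [← mul_assoc ((4 * (Real.pi * t)) ^ (-((d : ℝ) / 2))), h1, one_mul, ← Real.exp_add]
        congr 2; ring
    _ = _ := by
        rw [integral_complex_ofReal,
          Real.integral_rpow_mul_exp_neg_mul_Ioi (by norm_num) (by positivity),
          Real.Gamma_one_half_eq, ← Real.sqrt_eq_rpow, Real.sqrt_div' _ (by positivity),
          Real.sqrt_one]
        congr 1; ring

lemma isYukawaSqrtKernel_explicitKernel {m : ℝ} (hm : 0 < m) :
    IsYukawaSqrtKernel (d := d) m (explicitKernel m) := by
  refine ⟨(integrable_heatMix hm).integral_prod_left.const_mul _, fun K => ?_⟩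
  unfold fourierHat explicitKernel
  simp only [Complex.ofReal_mul, mul_assoc]
  rw [integral_const_mul, integral_heatMix_fourier hm, ← Complex.ofReal_mul, ← Complex.ofReal_mul]
  congr 1
  have : √Real.pi ≠ 0 := by positivity
  field_simp

/-- `yukawaSqrtKernel` is known only through its Fourier transform. Uniqueness up to null sets
allows the explicit mixture of heat kernels to replace it under every integral. -/
lemma yukawaSqrtKernel_sub_ae_eq {m : ℝ} (hm : 0 < m) (x : Space d) :
    ∀ᵐ y, yukawaSqrtKernel d m (x - y) = explicitKernel m (x - y) :=
  (quasiMeasurePreserving_sub_left volume x).ae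
    ((isYukawaSqrtKernel hm).ae_eq (isYukawaSqrtKernel_explicitKernel hm))

/-- The integrand in the definition of `majorant`. -/
def majorantIntegrand (z : Space d) (t : ℝ) : ℝ :=
  if t ≤ 1 then t ^ (-(1 / 2) : ℝ) * heatKernel t z else t ^ (-(3 / 2) : ℝ) * heatKernel (4 * t) z

lemma measurable_majorantIntegrand (z : Space d) : Measurable (majorantIntegrand z) := by
  unfold majorantIntegrand
  refine Measurable.ite measurableSet_Iic ?_ ?_
  · exact (by fun_prop : Measurable fun t : ℝ => t ^ (-(1 / 2) : ℝ)).mul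
      (measurable_heatKernel.comp (f := fun t : ℝ => (t, z)) (by fun_prop))
  · exact (by fun_prop : Measurable fun t : ℝ => t ^ (-(3 / 2) : ℝ)).mul
      (measurable_heatKernel.comp (f := fun t : ℝ => (4 * t, z)) (by fun_prop))

lemma majorantIntegrand_nonneg (z : Space d) {t : ℝ} (ht : 0 < t) :
    0 ≤ majorantIntegrand z t := by
  unfold majorantIntegrand
  have h1 := (heatKernel_pos ht z).le
  have h2 := (heatKernel_pos (by positivity : 0 < 4 * t) z).le
  split_ifs <;> positivity

lemma lintegral_majorantIntegrand (z : Space d) :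
    ∫⁻ t in Ioi (0 : ℝ), ENNReal.ofReal (majorantIntegrand z t) = majorant z := by
  rw [← Ioc_union_Ioi_eq_Ioi zero_le_one, lintegral_union measurableSet_Ioi
    (Set.Ioc_disjoint_Ioi le_rfl), majorant, smallKernel, largeKernel]
  congr 1
  · refine setLIntegral_congr_fun measurableSet_Ioc fun t ht => ?_
    rw [majorantIntegrand, if_pos ht.2, ENNReal.ofReal_mul (Real.rpow_nonneg ht.1.le _)]
  · refine setLIntegral_congr_fun measurableSet_Ioi fun t ht => ?_
    have ht : 1 < t := ht
    rw [majorantIntegrand, if_neg (not_le.2 ht),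
      ENNReal.ofReal_mul (Real.rpow_nonneg (by linarith) _)]

lemma integrableOn_majorantIntegrand {z : Space d} (hz : majorant z ≠ ∞) :
    IntegrableOn (majorantIntegrand z) (Ioi 0) := by
  refine ⟨(measurable_majorantIntegrand z).aestronglyMeasurable, ?_⟩
  rw [hasFiniteIntegral_iff_ofReal]
  · rw [lintegral_majorantIntegrand]; exact hz.lt_top
  · filter_upwards [ae_restrict_mem measurableSet_Ioi] with t ht
    exact majorantIntegrand_nonneg z ht

lemma enorm_integral_le_majorant {g : ℝ → ℝ} {C : ℝ} (hC : 0 ≤ C) {z : Space d}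
    (h : ∀ t, 0 < t → |g t| ≤ C * majorantIntegrand z t) :
    ‖∫ t in Ioi 0, g t‖ₑ ≤ ENNReal.ofReal C * majorant z := by
  refine (enorm_integral_le_lintegral_enorm _).trans ?_
  rw [← lintegral_majorantIntegrand, ← lintegral_const_mul' _ _ ENNReal.ofReal_ne_top]
  refine setLIntegral_mono' measurableSet_Ioi fun t ht => ?_
  rw [← ENNReal.ofReal_mul hC, Real.enorm_eq_ofReal_abs]
  exact ENNReal.ofReal_le_ofReal (h t ht)

lemma ae_majorant_sub_ne_top (x : Space d) : ∀ᵐ y, majorant (x - y) ≠ ∞ := by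
  refine (quasiMeasurePreserving_sub_left volume x).ae (p := fun z : Space d => majorant z ≠ ∞) ?_
  filter_upwards [ae_lt_top measurable_majorant lintegral_majorant_ne_top] with z hz using hz.ne

/-- For fixed `m > 0` no cancellation is needed: `e^{-m² t} ≤ 1 / (m² t)` supplies the missing
factor `t⁻¹` at large times. The constant degenerates as `m → 0`, so this serves for `𝒟_Y` but not
for the limit. -/
lemma exists_enorm_explicitKernel_le (d : ℕ) {m : ℝ} (hm : 0 < m) :
    ∃ C : ℝ≥0∞, C ≠ ∞ ∧ ∀ z : Space d, ‖explicitKernel m z‖ₑ ≤ C * majorant z := by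
  set C : ℝ := 1 + 4 ^ ((d : ℝ) / 2) / m ^ 2 with hC
  have hC0 : 0 ≤ 4 ^ ((d : ℝ) / 2) / m ^ 2 := by positivity
  refine ⟨‖√(sphereArea d) / √Real.pi‖ₑ * ENNReal.ofReal C, by finiteness, fun z => ?_⟩
  rw [explicitKernel, enorm_mul, mul_assoc]
  gcongr
  refine enorm_integral_le_majorant (by positivity) fun t ht => ?_
  have hg := heatKernel_pos ht z
  have hw := timeWeight_nonneg m ht
  rw [heatMix_eq, abs_of_nonneg (by positivity), majorantIntegrand]
  split_ifs with h1
  · calc timeWeight m t * heatKernel t z ≤ t ^ (-(1 / 2) : ℝ) * heatKernel t z := by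
          gcongr; exact timeWeight_le m ht
      _ ≤ _ := le_mul_of_one_le_left (by positivity) (by linarith)
  · have h2 := heatKernel_le_mul_heatKernel (a := 0) ht (by positivity : 0 < 4 * t)
      (z := z) (z' := z) (by
        rw [add_zero]
        gcongr
        linarith)
    rw [mul_div_cancel_right₀ _ ht.ne', Real.exp_zero, mul_one] at h2
    have h3 : Real.exp (-(m ^ 2 * t)) ≤ 1 / (m ^ 2 * t) := by
      rw [Real.exp_neg, ← one_div]
      refine one_div_le_one_div_of_le (by positivity) ?_
      linarith [Real.add_one_le_exp (m ^ 2 * t)]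
    have hg4 := heatKernel_pos (by positivity : 0 < 4 * t) z
    have e : t ^ (-(3 / 2) : ℝ) = t ^ ((1 / 2 : ℝ) - 1) * (1 / t) := by
      rw [one_div t, ← Real.rpow_neg_one t, ← Real.rpow_add ht]; norm_num
    calc timeWeight m t * heatKernel t z
        ≤ (t ^ ((1 / 2 : ℝ) - 1) * (1 / (m ^ 2 * t))) *
          (4 ^ ((d : ℝ) / 2) * heatKernel (4 * t) z) := by
          unfold timeWeight
          gcongr
      _ = (4 ^ ((d : ℝ) / 2) / m ^ 2) * (t ^ (-(3 / 2) : ℝ) * heatKernel (4 * t) z) := by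
          rw [e]; field_simp
      _ ≤ _ := by
          gcongr
          linarith

/-- The base point of the cell of `y`. -/
def cellPoint (y : Space d) : Space d := latticePoint (cellIndex y)

lemma measurable_cellPoint : Measurable (cellPoint (d := d)) :=
  (measurable_of_countable latticePoint).comp measurable_cellIndex

lemma norm_cellPoint_sub_sq_le (y : Space d) : ‖cellPoint y - y‖ ^ 2 ≤ d :=
  norm_sub_sq_le_of_mem_cell (latticePoint_mem_cell (cellIndex y)) rfl

/-- The heat kernel as a function of `y`, minus its first order Taylor polynomials at the centers
of the cells for large times. -/
def heatSub (t : ℝ) (x y : Space d) : ℝ :=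
  if t ≤ 1 then heatKernel t (x - y) else heatRemainder t (x - cellPoint y) (cellPoint y - y)

lemma measurable_heatSub (x : Space d) :
    Measurable fun p : Space d × ℝ => heatSub p.2 x p.1 := by
  have hc := measurable_cellPoint (d := d)
  unfold heatSub heatRemainder
  refine Measurable.ite (measurableSet_le measurable_snd measurable_const) ?_ ?_
  · exact measurable_heatKernel.comp (f := fun p : Space d × ℝ => (p.2, x - p.1)) (by fun_prop)
  · refine Measurable.sub ?_ (Measurable.mul ?_ (by fun_prop))
    · exact measurable_heatKernel.comp
        (f := fun p : Space d × ℝ => (p.2, x - cellPoint p.1 + (cellPoint p.1 - p.1)))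
        (by fun_prop)
    · exact measurable_heatKernel.comp
        (f := fun p : Space d × ℝ => (p.2, x - cellPoint p.1)) (by fun_prop)

/-- The constant does not depend on `m`, because `e^{-m² t} ≤ 1`. For `t ≤ 1` nothing is subtracted:
`t^{-1/2}` is already integrable at `0`. For `t > 1` the Taylor remainder gives `t^{-3/2}`. -/
lemma exists_abs_timeWeight_mul_heatSub_le (d : ℕ) : ∃ C : ℝ, 0 ≤ C ∧
    ∀ (m t : ℝ) (x y : Space d), 0 < t →
      |timeWeight m t * heatSub t x y| ≤ C * majorantIntegrand (x - y) t := by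
  obtain ⟨C, hC, h⟩ := exists_abs_heatRemainder_le d
  refine ⟨1 + C, by positivity, fun m t x y ht => ?_⟩
  have hw := timeWeight_nonneg m ht
  rw [abs_mul, abs_of_nonneg hw, heatSub, majorantIntegrand]
  split_ifs with h1
  · have hg := heatKernel_pos ht (x - y)
    rw [abs_of_pos hg]
    calc timeWeight m t * heatKernel t (x - y) ≤ t ^ (-(1 / 2) : ℝ) * heatKernel t (x - y) := by
          gcongr; exact timeWeight_le m ht
      _ ≤ _ := le_mul_of_one_le_left (by positivity) (by linarith)
  · have hg := heatKernel_pos (by positivity : 0 < 4 * t) (x - y)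
    have h2 := h t (not_le.1 h1).le (x - cellPoint y) (cellPoint y - y) (norm_cellPoint_sub_sq_le y)
    rw [sub_add_sub_cancel] at h2
    have e : t ^ (-(3 / 2) : ℝ) = t ^ (-(1 / 2) : ℝ) * t⁻¹ := by
      rw [← Real.rpow_neg_one, ← Real.rpow_add ht]; norm_num
    calc _ ≤ t ^ (-(1 / 2) : ℝ) * (C * (t⁻¹ * heatKernel (4 * t) (x - y))) := by
          gcongr
          exact timeWeight_le m ht
      _ = C * (t ^ (-(3 / 2) : ℝ) * heatKernel (4 * t) (x - y)) := by rw [e]; ring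
      _ ≤ _ := by
          gcongr
          linarith

/-- The kernel `W_m(x - y)` minus a function of `y` which is affine in each cell. -/
def subtractedKernel (m : ℝ) (x y : Space d) : ℝ :=
  (√(sphereArea d) / √Real.pi) * ∫ t in Ioi 0, timeWeight m t * heatSub t x y

lemma measurable_subtractedKernel (m : ℝ) (x : Space d) :
    Measurable (subtractedKernel m x) := by
  unfold subtractedKernel
  refine Measurable.const_mul ?_ _
  have h : Measurable fun p : Space d × ℝ => timeWeight m p.2 * heatSub p.2 x p.1 :=
    ((measurable_timeWeight m).comp measurable_snd).mul (measurable_heatSub x)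
  exact (h.stronglyMeasurable.integral_prod_right').measurable

lemma exists_enorm_subtractedKernel_le (d : ℕ) : ∃ C : ℝ≥0∞, C ≠ ∞ ∧
    ∀ (m : ℝ) (x y : Space d), ‖subtractedKernel m x y‖ₑ ≤ C * majorant (x - y) := by
  obtain ⟨C, hC, h⟩ := exists_abs_timeWeight_mul_heatSub_le d
  refine ⟨‖√(sphereArea d) / √Real.pi‖ₑ * ENNReal.ofReal C, by finiteness, fun m x y => ?_⟩
  rw [subtractedKernel, enorm_mul, mul_assoc]
  gcongr
  exact enorm_integral_le_majorant hC fun t ht => h m t x y ht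

lemma tendsto_subtractedKernel {x y : Space d} (hxy : majorant (x - y) ≠ ∞) :
    Tendsto (fun m => subtractedKernel m x y) (𝓝[>] 0) (𝓝 (subtractedKernel 0 x y)) := by
  obtain ⟨C, hC, h⟩ := exists_abs_timeWeight_mul_heatSub_le d
  unfold subtractedKernel
  refine Tendsto.const_mul _ ?_
  refine tendsto_integral_filter_of_dominated_convergence
    (fun t => C * majorantIntegrand (x - y) t) ?_ ?_
    ((integrableOn_majorantIntegrand hxy).const_mul C) ?_
  · refine Eventually.of_forall fun m => Measurable.aestronglyMeasurable ?_
    exact (measurable_timeWeight m).mul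
      ((measurable_heatSub x).comp (f := fun t : ℝ => (y, t)) (by fun_prop))
  · refine Eventually.of_forall fun m => ?_
    filter_upwards [ae_restrict_mem measurableSet_Ioi] with t ht using h m t x y ht
  · refine ae_of_all _ fun t => Tendsto.mul_const _ ?_
    unfold timeWeight
    have : Continuous fun m : ℝ => t ^ ((1 / 2 : ℝ) - 1) * Real.exp (-(m ^ 2 * t)) := by fun_prop
    exact (this.tendsto 0).mono_left nhdsWithin_le_nhds

/-- Gives integrability in time of the two Taylor coefficients, for `g = 1` and `g = 1 / (2t)`, so
that the integral over `t` can be split. Here `m > 0` is essential for the convergence of `∫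
timeWeight m`. -/
lemma integrableOn_timeWeight_mul_heatKernel {m : ℝ} (hm : 0 < m) (p : Space d) {g : ℝ → ℝ}
    (hg : Measurable g) (hg1 : ∀ t, 1 < t → |g t| ≤ 1) :
    IntegrableOn (fun t => timeWeight m t * (Ioi (1 : ℝ)).indicator
      (fun t => heatKernel t p * g t) t) (Ioi 0) := by
  have hi : IntegrableOn (timeWeight m) (Ioi 0) := by
    have := integrableOn_rpow_mul_exp_neg_mul_rpow (p := 1) (s := (1 / 2 : ℝ) - 1)
      (b := m ^ 2) (by norm_num) one_pos (by positivity)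
    have e : timeWeight m = fun t => t ^ ((1 / 2 : ℝ) - 1) * Real.exp (-(m ^ 2 * t)) := rfl
    rw [e]
    simpa using this
  refine hi.mul_bdd (c := 1) ?_ (ae_of_all _ fun t => ?_)
  · exact (((measurable_heatKernel.comp (f := fun t : ℝ => (t, p)) (by fun_prop)).mul
      hg).indicator measurableSet_Ioi).aestronglyMeasurable
  · by_cases ht : t ∈ Ioi (1 : ℝ)
    · have ht1 : 1 < t := ht
      have ht0 : 0 < t := by linarith
      rw [indicator_of_mem ht, norm_mul, Real.norm_eq_abs, Real.norm_eq_abs,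
        abs_of_pos (heatKernel_pos ht0 p)]
      have h1 : heatKernel t p ≤ 1 := (heatKernel_le ht0 p).trans
        (Real.rpow_le_one_of_one_le_of_nonpos ht1.le (by simp; positivity))
      exact mul_le_one₀ h1 (abs_nonneg _) (hg1 t ht1)
    · simp [indicator_of_notMem ht]

/-- `subtractedKernel` differs from `W_m` by a function which is affine in each cell. -/
lemma exists_subtractedKernel_eq {m : ℝ} (hm : 0 < m) (x : Space d) :
    ∃ a b : (Fin d → ℤ) → ℝ, ∀ᵐ y, subtractedKernel m x y = explicitKernel m (x - y) -
      (a (cellIndex y) - b (cellIndex y) * inner ℝ (x - cellPoint y) (cellPoint y - y)) := by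
  refine ⟨fun k => (√(sphereArea d) / √Real.pi) * ∫ t in Ioi 0, timeWeight m t *
      (Ioi (1 : ℝ)).indicator (fun t => heatKernel t (x - latticePoint k) * 1) t,
    fun k => (√(sphereArea d) / √Real.pi) * ∫ t in Ioi 0, timeWeight m t *
      (Ioi (1 : ℝ)).indicator (fun t => heatKernel t (x - latticePoint k) * (1 / (2 * t))) t, ?_⟩
  have hi := (quasiMeasurePreserving_sub_left volume x).ae
    ((integrable_heatMix (d := d) hm).prod_right_ae)
  filter_upwards [hi] with y hy
  set p := x - cellPoint y with hp
  set v := cellPoint y - y with hv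
  have hpk : x - latticePoint (cellIndex y) = p := rfl
  have i1 := integrableOn_timeWeight_mul_heatKernel hm p (g := fun _ => 1) measurable_const
    (by simp)
  have i2 := integrableOn_timeWeight_mul_heatKernel hm p (g := fun t => 1 / (2 * t)) (by fun_prop)
    (fun t ht => by
      rw [abs_of_pos (by positivity), div_le_one (by positivity)]; linarith)
  have e : ∀ t, timeWeight m t * heatSub t x y = heatMix m (x - y, t) -
      (timeWeight m t * (Ioi (1 : ℝ)).indicator (fun t => heatKernel t p * 1) t -
        (timeWeight m t * (Ioi (1 : ℝ)).indicator (fun t => heatKernel t p * (1 / (2 * t))) t) *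
          inner ℝ p v) := by
    intro t
    rw [heatMix_eq, heatSub]
    split_ifs with ht
    · rw [indicator_of_notMem (by simpa using ht), indicator_of_notMem (by simpa using ht)]
      ring
    · have ht' : t ∈ Ioi (1 : ℝ) := not_le.1 ht
      rw [indicator_of_mem ht', indicator_of_mem ht', heatRemainder, hp, hv, sub_add_sub_cancel]
      ring
  have i2' := i2.mul_const (inner ℝ p v)
  have i3 : IntegrableOn (fun t => timeWeight m t * (Ioi (1 : ℝ)).indicator
      (fun t => heatKernel t p * 1) t - (timeWeight m t * (Ioi (1 : ℝ)).indicator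
        (fun t => heatKernel t p * (1 / (2 * t))) t) * inner ℝ p v) (Ioi 0) := i1.sub i2'
  rw [subtractedKernel, explicitKernel, hpk]
  simp only [e]
  rw [integral_sub hy i3, integral_sub i1 i2', integral_mul_const]
  ring

lemma integral_eq_zero_of_cell {E : Type*} [NormedAddCommGroup E] [NormedSpace ℝ E]
    {h : Space d → E} (hc : ∀ k, ∫ y in cell k, h y = 0) : ∫ y, h y = 0 := by
  by_cases hi : Integrable h
  · rw [← setIntegral_univ, ← iUnion_cell, integral_iUnion measurableSet_cell
      pairwise_disjoint_cell hi.integrableOn]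
    simp [hc]
  -- For a non-integrable function the integral is `0` by convention.
  · exact integral_undef hi

/-- The multipole moments of order at most one of `f` vanish in each cell. -/
structure CellNeutral (f : Space d → ℂ) : Prop where
  integrableOn : ∀ k, IntegrableOn f (cell k)
  charge : ∀ k, ∫ y in cell k, f y = 0
  dipole : ∀ k, ∀ i, ∫ y in cell k, (y i : ℂ) * f y = 0

lemma abs_apply_le_of_mem_cell {k : Fin d → ℤ} {y : Space d} (hy : y ∈ cell k) (i : Fin d) :
    |y i| ≤ |(k i : ℝ)| + 1 := by
  have h := mem_cell_iff.1 hy i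
  rw [mem_Ico] at h
  have : |y i - k i| ≤ 1 := by rw [abs_le]; constructor <;> linarith
  linarith [abs_sub_abs_le_abs_sub (y i) (k i)]

lemma integrableOn_apply_mul_cell {f : Space d → ℂ} {k : Fin d → ℤ}
    (hf : IntegrableOn f (cell k)) (i : Fin d) :
    IntegrableOn (fun y => (y i : ℂ) * f y) (cell k) := by
  refine hf.bdd_mul (c := |(k i : ℝ)| + 1) ?_ ?_
  · exact (by fun_prop : Measurable fun y : Space d => (y i : ℂ)).aestronglyMeasurable
  · filter_upwards [ae_restrict_mem (measurableSet_cell k)] with y hy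
    simpa using abs_apply_le_of_mem_cell hy i

lemma CellNeutral.integral_affine {f : Space d → ℂ} (hf : CellNeutral f) (k : Fin d → ℤ) (a : ℝ)
    (p : Space d) :
    ∫ y in cell k, f y * ((a + inner ℝ p y : ℝ) : ℂ) = 0 := by
  have e : ∀ y : Space d, f y * ((a + inner ℝ p y : ℝ) : ℂ) =
      f y * (a : ℂ) + ∑ i, (p i : ℂ) * ((y i : ℂ) * f y) := by
    intro y
    rw [EuclideanSpace.inner_eq_star_dotProduct]
    simp only [dotProduct, Complex.ofReal_add, Complex.ofReal_sum, mul_add, Finset.mul_sum]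
    congr 1
    refine Finset.sum_congr rfl fun i _ => ?_
    simp
    ring
  simp only [e]
  rw [integral_add ((hf.integrableOn k).mul_const _)
    (integrable_finsetSum _ fun i _ => (integrableOn_apply_mul_cell (hf.integrableOn k) i).const_mul _),
    integral_mul_const, hf.charge, zero_mul, zero_add, integral_finsetSum]
  · refine Finset.sum_eq_zero fun i _ => ?_
    rw [integral_const_mul, hf.dipole, mul_zero]
  · exact fun i _ => (integrableOn_apply_mul_cell (hf.integrableOn k) i).const_mul _

lemma integrable_mul_of_enorm_le_majorant {f : Space d → ℂ} (hf : Measurable f) {x : Space d}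
    (hJ : ∫⁻ y, majorant (x - y) * ‖f y‖ₑ ≠ ∞) {κ : Space d → ℝ}
    (hκ : AEStronglyMeasurable κ) {C : ℝ≥0∞} (hC : C ≠ ∞)
    (h : ∀ᵐ y, ‖κ y‖ₑ ≤ C * majorant (x - y)) :
    Integrable fun y => f y * (κ y : ℂ) := by
  refine ⟨hf.aestronglyMeasurable.mul
    (Complex.continuous_ofReal.comp_aestronglyMeasurable hκ), ?_⟩
  calc ∫⁻ y, ‖f y * (κ y : ℂ)‖ₑ ≤ ∫⁻ y, C * (majorant (x - y) * ‖f y‖ₑ) := by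
        refine lintegral_mono_ae ?_
        filter_upwards [h] with y hy
        rw [enorm_mul, mul_comm, ← mul_assoc]
        gcongr
        simpa [enorm_eq_nnnorm] using hy
    _ < ∞ := by
        rw [lintegral_const_mul' _ _ hC]
        exact ENNReal.mul_lt_top hC.lt_top hJ.lt_top

lemma integrable_mul_yukawaSqrtKernel {f : Space d → ℂ} (hf : Measurable f) {x : Space d}
    (hJ : ∫⁻ y, majorant (x - y) * ‖f y‖ₑ ≠ ∞) {m : ℝ} (hm : 0 < m) :
    Integrable fun y => f y * (yukawaSqrtKernel d m (x - y) : ℂ) := by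
  obtain ⟨C, hC, h⟩ := exists_enorm_explicitKernel_le d hm
  refine integrable_mul_of_enorm_le_majorant hf hJ
    ((isYukawaSqrtKernel hm).integrable.comp_sub_left x).aestronglyMeasurable hC ?_
  filter_upwards [yukawaSqrtKernel_sub_ae_eq hm x] with y hy
  rw [hy]
  exact h _

lemma integrable_mul_subtractedKernel {f : Space d → ℂ} (hf : Measurable f) {x : Space d}
    (hJ : ∫⁻ y, majorant (x - y) * ‖f y‖ₑ ≠ ∞) (m : ℝ) :
    Integrable fun y => f y * (subtractedKernel m x y : ℂ) := by
  obtain ⟨C, hC, h⟩ := exists_enorm_subtractedKernel_le d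
  exact integrable_mul_of_enorm_le_majorant hf hJ
    (measurable_subtractedKernel m x).aestronglyMeasurable hC (ae_of_all _ (h m x))

/-- In each cell the two kernels differ by an affine function of `y`, which is orthogonal to `f`
there. Both integrands are integrable over the whole space by the `majorant` bounds, so the integral
of the difference may be computed cell by cell. -/
lemma CellNeutral.integral_mul_yukawaSqrtKernel {f : Space d → ℂ} (hn : CellNeutral f)
    (hf : Measurable f) {x : Space d} (hJ : ∫⁻ y, majorant (x - y) * ‖f y‖ₑ ≠ ∞) {m : ℝ}
    (hm : 0 < m) :
    ∫ y, f y * (yukawaSqrtKernel d m (x - y) : ℂ) = ∫ y, f y * (subtractedKernel m x y : ℂ) := by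
  rw [← sub_eq_zero, ← integral_sub (integrable_mul_yukawaSqrtKernel hf hJ hm)
    (integrable_mul_subtractedKernel hf hJ m)]
  obtain ⟨a, b, hab⟩ := exists_subtractedKernel_eq hm x
  refine integral_eq_zero_of_cell fun k => ?_
  rw [← hn.integral_affine k (a k - b k * inner ℝ (x - latticePoint k) (latticePoint k))
    (b k • (x - latticePoint k))]
  refine integral_congr_ae ?_
  filter_upwards [ae_restrict_of_ae hab, ae_restrict_of_ae (yukawaSqrtKernel_sub_ae_eq hm x),
    ae_restrict_mem (measurableSet_cell k)] with y h1 h2 hy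
  have hy : cellIndex y = k := hy
  rw [h1, h2, cellPoint, hy, ← mul_sub, ← Complex.ofReal_sub, inner_sub_right, inner_smul_left]
  congr 2
  simp only [conj_trivial]
  ring

/-- Dominated convergence in `y` after the subtraction; the kernels `W_m` themselves have no
dominating function of this kind that is uniform in `m`. -/
lemma CellNeutral.tendsto_integral_mul_yukawaSqrtKernel {f : Space d → ℂ} (hn : CellNeutral f)
    (hf : Measurable f) {x : Space d} (hJ : ∫⁻ y, majorant (x - y) * ‖f y‖ₑ ≠ ∞) :
    Tendsto (fun m => ∫ y, f y * (yukawaSqrtKernel d m (x - y) : ℂ)) (𝓝[>] 0)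
      (𝓝 (∫ y, f y * (subtractedKernel 0 x y : ℂ))) := by
  obtain ⟨C, hC, h⟩ := exists_enorm_subtractedKernel_le d
  have hlim : Tendsto (fun m => ∫ y, f y * (subtractedKernel m x y : ℂ)) (𝓝[>] 0)
      (𝓝 (∫ y, f y * (subtractedKernel 0 x y : ℂ))) := by
    have hM : Measurable fun y => majorant (x - y) * ‖f y‖ₑ :=
      (measurable_majorant.comp (by fun_prop)).mul hf.enorm
    have hfin : ∫⁻ y, C * (majorant (x - y) * ‖f y‖ₑ) ≠ ∞ := by
      rw [lintegral_const_mul' _ _ hC]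
      exact ENNReal.mul_ne_top hC hJ
    refine tendsto_integral_filter_of_dominated_convergence
      (fun y => (C * (majorant (x - y) * ‖f y‖ₑ)).toReal) ?_ ?_
      (integrable_toReal_of_lintegral_ne_top (hM.const_mul C).aemeasurable hfin) ?_
    · exact Eventually.of_forall fun m => (integrable_mul_subtractedKernel hf hJ m).1
    · refine Eventually.of_forall fun m => ?_
      filter_upwards [ae_lt_top (hM.const_mul C) hfin] with y hy
      rw [← toReal_enorm]
      refine ENNReal.toReal_mono hy.ne ?_
      rw [enorm_mul, mul_comm, ← mul_assoc]
      gcongr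
      simpa [enorm_eq_nnnorm] using h m x y
    · filter_upwards [ae_majorant_sub_ne_top x] with y hy
      exact ((Complex.continuous_ofReal.tendsto _).comp
        (tendsto_subtractedKernel hy)).const_mul _
  refine hlim.congr' ?_
  filter_upwards [self_mem_nhdsWithin] with m hm
  exact (hn.integral_mul_yukawaSqrtKernel hf hJ hm).symm

lemma enorm_integral_mul_le {f : Space d → ℂ} {κ : Space d → ℝ} {C : ℝ≥0∞} (hC : C ≠ ∞)
    {x : Space d} (h : ∀ᵐ y, ‖κ y‖ₑ ≤ C * majorant (x - y)) :
    ‖∫ y, f y * (κ y : ℂ)‖ₑ ≤ C * ∫⁻ y, majorant (x - y) * ‖f y‖ₑ := by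
  refine (enorm_integral_le_lintegral_enorm _).trans ?_
  rw [← lintegral_const_mul' _ _ hC]
  refine lintegral_mono_ae ?_
  filter_upwards [h] with y hy
  rw [enorm_mul, mul_comm, ← mul_assoc]
  gcongr
  simpa [enorm_eq_nnnorm] using hy

end

end StationaryCoulomb

/-! ### Stationary functions: invariance under almost everywhere equality, integrability, neutrality
of all cells. -/

namespace StationaryCoulomb

noncomputable section

variable {d : ℕ} {Ω : Type*} [MeasurableSpace Ω]

lemma ae_prod_of_ae_fst {P : Measure Ω} {p : Ω × Space d → Prop}
    (h : ∀ᵐ ω ∂P, ∀ x, p (ω, x)) : ∀ᵐ z ∂(P.prod volume), p z := by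
  filter_upwards [Measure.quasiMeasurePreserving_fst.ae h] with z hz using hz z.2

lemma eLpNorm_two_lt_top_iff (P : Measure Ω) (g : Ω → ℝ≥0∞) :
    eLpNorm g 2 P < ∞ ↔ ∫⁻ ω, g ω ^ 2 ∂P < ∞ := by
  rw [eLpNorm_lt_top_iff_lintegral_rpow_enorm_lt_top (by norm_num) (by norm_num)]
  simp

lemma eLpNorm_two_sq {α E : Type*} [MeasurableSpace α] [NormedAddCommGroup E] (μ : Measure α)
    (g : α → E) : eLpNorm g 2 μ ^ 2 = ∫⁻ x, ‖g x‖ₑ ^ 2 ∂μ := by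
  rw [eLpNorm_eq_lintegral_rpow_enorm_toReal (by norm_num) (by norm_num), ← ENNReal.rpow_natCast,
    ← ENNReal.rpow_mul]
  simp

lemma eLpNorm_ofReal_sq {α E : Type*} [MeasurableSpace α] [NormedAddCommGroup E] (μ : Measure α)
    (g : α → E) {q : ℝ} (hq : 0 < q) :
    eLpNorm g (ENNReal.ofReal q) μ ^ 2 = (∫⁻ x, ‖g x‖ₑ ^ q ∂μ) ^ (2 / q) := by
  rw [eLpNorm_eq_lintegral_rpow_enorm_toReal (by simpa using hq) ENNReal.ofReal_ne_top,
    ← ENNReal.rpow_natCast, ← ENNReal.rpow_mul, ENNReal.toReal_ofReal hq.le]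
  congr 1
  push_cast
  ring

lemma ae_eq_slice {P : Measure Ω} [SFinite P]
    {f g : Ω × Space d → ℂ} (h : f =ᵐ[P.prod volume] g) :
    ∀ᵐ ω ∂P, (fun x => f (ω, x)) =ᵐ[volume] fun x => g (ω, x) :=
  Measure.ae_ae_of_ae_prod h

lemma measurable_explicitKernel {m : ℝ} : Measurable (explicitKernel (d := d) m) := by
  unfold explicitKernel
  exact ((measurable_heatMix m).stronglyMeasurable.integral_prod_right').measurable.const_mul _

lemma stronglyMeasurable_yukawaConv {m : ℝ} (hm : 0 < m) {f : Ω × Space d → ℂ}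
    (hf : Measurable f) : StronglyMeasurable (yukawaConv m f) := by
  have e : yukawaConv m f =
      fun z => ∫ y, f (z.1, y) * (explicitKernel m (z.2 - y) : ℂ) := by
    ext z
    refine integral_congr_ae ?_
    filter_upwards [yukawaSqrtKernel_sub_ae_eq hm z.2] with y hy
    rw [hy]
  rw [e]
  have hk := measurable_explicitKernel (d := d) (m := m)
  have h : Measurable fun p : (Ω × Space d) × Space d =>
      f (p.1.1, p.2) * (explicitKernel m (p.1.2 - p.2) : ℂ) :=
    (hf.comp (f := fun p : (Ω × Space d) × Space d => (p.1.1, p.2)) (by fun_prop)).mul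
      (Complex.measurable_ofReal.comp (hk.comp (by fun_prop)))
  exact h.stronglyMeasurable.integral_prod_right'

lemma ae_yukawaConv_eq {P : Measure Ω} [SFinite P] {f g : Ω × Space d → ℂ}
    (h : f =ᵐ[P.prod volume] g) :
    ∀ᵐ ω ∂P, ∀ (m : ℝ) (x : Space d), yukawaConv m f (ω, x) = yukawaConv m g (ω, x) := by
  filter_upwards [ae_eq_slice h] with ω hω m x
  refine integral_congr_ae ?_
  filter_upwards [hω] with y hy
  simp only [hy]

lemma yukawaEnergy_congr {P : Measure Ω} [SFinite P] {f g : Ω × Space d → ℂ}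
    (m : ℝ) (h : f =ᵐ[P.prod volume] g) :
    yukawaEnergy P m f = yukawaEnergy P m g := by
  refine lintegral_congr_ae ?_
  filter_upwards [ae_yukawaConv_eq h] with ω hω
  simp only [hω]

lemma ae_cellCharge_eq {P : Measure Ω} [SFinite P] {f g : Ω × Space d → ℂ}
    (h : f =ᵐ[P.prod volume] g) :
    ∀ᵐ ω ∂P, cellCharge f ω = cellCharge g ω := by
  filter_upwards [ae_eq_slice h] with ω hω
  exact integral_congr_ae (ae_restrict_of_ae hω)

lemma ae_cellDipole_eq {P : Measure Ω} [SFinite P] {f g : Ω × Space d → ℂ}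
    (h : f =ᵐ[P.prod volume] g) :
    ∀ᵐ ω ∂P, cellDipole f ω = cellDipole g ω := by
  filter_upwards [ae_eq_slice h] with ω hω
  ext i
  refine integral_congr_ae ?_
  filter_upwards [ae_restrict_of_ae hω] with x hx
  simp only [hx]

variable [AddAction (Fin d → ℤ) Ω]

section Congr

variable {P : Measure Ω} {f g : Ω × Space d → ℂ}

lemma IsStationary.congr [SFinite P] [MeasurableConstVAdd (Fin d → ℤ) Ω]
    [VAddInvariantMeasure (Fin d → ℤ) Ω P] (hf : IsStationary P f)
    (h : f =ᵐ[P.prod volume] g) : IsStationary P g := by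
  intro k
  have h1 := ((measurePreserving_vadd k P).prod
    (MeasurePreserving.id (volume : Measure (Space d)))).quasiMeasurePreserving.ae h
  have h2 := ((MeasurePreserving.id P).prod
    (measurePreserving_add_left (volume : Measure (Space d))
      (latticePoint k))).quasiMeasurePreserving.ae h
  filter_upwards [hf k, h1, h2] with z h0 h1 h2
  simp only [Prod.map, id] at h1 h2
  rw [← h1, ← h2, h0]

lemma MemLs.congr [SFinite P] [MeasurableConstVAdd (Fin d → ℤ) Ω]
    [VAddInvariantMeasure (Fin d → ℤ) Ω P] {p q : ℝ≥0∞} (hf : MemLs P p q f)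
    (h : f =ᵐ[P.prod volume] g) : MemLs P p q g := by
  refine ⟨hf.aestronglyMeasurable.congr h, hf.stationary.congr h, fun K hK => ?_⟩
  refine lt_of_eq_of_lt (eLpNorm_congr_ae ?_) (hf.eLpNorm_lt_top K hK)
  filter_upwards [ae_eq_slice h] with ω hω
  exact (eLpNorm_congr_ae (ae_restrict_of_ae hω)).symm

lemma MemDY.congr [SFinite P] [MeasurableConstVAdd (Fin d → ℤ) Ω]
    [VAddInvariantMeasure (Fin d → ℤ) Ω P] (hf : MemDY P f)
    (h : f =ᵐ[P.prod volume] g) : MemDY P g := by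
  refine ⟨hf.memLs.congr h, fun m hm => ?_, fun m hm => (hf.memLs_conv m hm).congr ?_⟩
  · have h' : ∀ᵐ z ∂(P.prod (volume : Measure (Space d))),
        (fun x => f (z.1, x)) =ᵐ[volume] fun x => g (z.1, x) :=
      Measure.quasiMeasurePreserving_fst.ae (ae_eq_slice h)
    filter_upwards [hf.integrable_conv m hm, h'] with z h1 h2
    refine h1.congr ?_
    filter_upwards [h2] with y hy
    simp only [hy]
  · exact ae_prod_of_ae_fst ((ae_yukawaConv_eq h).mono fun ω hω x => hω m x)

lemma MemDC.congr [SFinite P] [MeasurableConstVAdd (Fin d → ℤ) Ω]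
    [VAddInvariantMeasure (Fin d → ℤ) Ω P] (hf : MemDC P f)
    (h : f =ᵐ[P.prod volume] g) : MemDC P g := by
  obtain ⟨D₀, hD⟩ := hf.finite_limit
  refine ⟨hf.memDY.congr h, D₀, hD.congr fun m => yukawaEnergy_congr m ?_⟩
  have hc : meanCharge P f = meanCharge P g := integral_congr_ae (ae_cellCharge_eq h)
  filter_upwards [h] with z hz
  rw [hz, hc]

end Congr

lemma IsStationary.ae_ae {P : Measure Ω} [SFinite P] {f : Ω × Space d → ℂ}
    (hf : IsStationary P f) (k : Fin d → ℤ) :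
    ∀ᵐ ω ∂P, ∀ᵐ x, f (k +ᵥ ω, x) = f (ω, latticePoint k + x) :=
  Measure.ae_ae_of_ae_prod (hf k)

/-- Lowering the exponent is needed in dimension two, where `q` may exceed `2` or be infinite while
the Hardy–Littlewood–Sobolev inequality is stated for exponents at most `2`. -/
lemma MemLs.lintegral_eLpNorm_sq_lt_top {P : Measure Ω} [SFinite P] {q r : ℝ≥0∞} (hr : r ≤ q)
    {f : Ω × Space d → ℂ} (hf : MemLs P 2 q f) {K : Set (Space d)} (hK : IsCompact K) :
    ∫⁻ ω, eLpNorm (fun x => f (ω, x)) r (volume.restrict K) ^ 2 ∂P < ∞ := by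
  rcases eq_or_ne r 0 with rfl | hr0
  · simp
  set c : ℝ≥0∞ := volume.restrict K univ ^ (1 / r.toReal - 1 / q.toReal) with hc
  have hcfin : c ≠ ∞ := by
    refine ENNReal.rpow_ne_top_of_nonneg ?_ ?_
    -- For `q = ∞`, `q.toReal` is `0` and `1 / 0 = 0`, which is the correct Hölder exponent.
    · rcases eq_or_ne q ∞ with rfl | hq
      · simp
      · rw [sub_nonneg]
        exact one_div_le_one_div_of_le (ENNReal.toReal_pos hr0 (ne_top_of_le_ne_top hq hr))
          (ENNReal.toReal_mono hq hr)
    · rw [Measure.restrict_apply_univ]; exact hK.measure_lt_top.ne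
  have h := (eLpNorm_two_lt_top_iff P _).1 (hf.eLpNorm_lt_top K hK)
  calc _ ≤ ∫⁻ ω, c ^ 2 * eLpNorm (fun x => f (ω, x)) q (volume.restrict K) ^ 2 ∂P := by
        refine lintegral_mono_ae ?_
        filter_upwards [hf.aestronglyMeasurable.prodMk_left] with ω hω
        rw [← mul_pow, mul_comm]
        gcongr
        exact eLpNorm_le_eLpNorm_mul_rpow_measure_univ hr hω.restrict
    _ = c ^ 2 * ∫⁻ ω, eLpNorm (fun x => f (ω, x)) q (volume.restrict K) ^ 2 ∂P :=
        lintegral_const_mul' _ _ (by finiteness)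
    _ < ∞ := ENNReal.mul_lt_top (by finiteness) h

lemma MemLs.lintegral_lintegral_enorm_lt_top {P : Measure Ω} [IsProbabilityMeasure P] {q : ℝ≥0∞}
    (hq : 1 ≤ q) {f : Ω × Space d → ℂ} (hfm : Measurable f) (hf : MemLs P 2 q f)
    {K : Set (Space d)} (hK : IsCompact K) :
    ∫⁻ ω, (∫⁻ x in K, ‖f (ω, x)‖ₑ) ∂P < ∞ := by
  have h := hf.lintegral_eLpNorm_sq_lt_top hq hK
  simp only [eLpNorm_one_eq_lintegral_enorm] at h
  -- Cauchy–Schwarz on the probability space bounds the first moment by the second.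
  have h2 := lintegral_mul_sq_le P (k := fun _ => 1) (f := fun ω => ∫⁻ x in K, ‖f (ω, x)‖ₑ)
    aemeasurable_const (Measurable.lintegral_prod_right' (f := fun z => ‖f z‖ₑ)
      hfm.enorm).aemeasurable
  simp only [one_mul, lintegral_one, measure_univ] at h2
  have h3 := h2.trans_lt h
  rw [lt_top_iff_ne_top] at h3 ⊢
  exact fun h4 => h3 (by rw [h4]; norm_num)

lemma MemLs.memLs_one {P : Measure Ω} [IsProbabilityMeasure P] {q : ℝ≥0∞} (hq : 1 ≤ q)
    {f : Ω × Space d → ℂ} (hfm : Measurable f) (hf : MemLs P 2 q f) : MemLs P 1 1 f := by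
  refine ⟨hf.aestronglyMeasurable, hf.stationary, fun K hK => ?_⟩
  simp only [eLpNorm_one_eq_lintegral_enorm, enorm_eq_self]
  exact hf.lintegral_lintegral_enorm_lt_top hq hfm hK

lemma cell_subset_closedBall (k : Fin d → ℤ) :
    cell k ⊆ Metric.closedBall (0 : Space d) (‖latticePoint (d := d) k‖ + √d) := by
  intro y hy
  have h := norm_sub_sq_le_of_mem_cell hy (latticePoint_mem_cell k)
  rw [mem_closedBall_zero_iff]
  linarith [Real.le_sqrt_of_sq_le h, norm_sub_norm_le y (latticePoint k)]

/-- The moments of `f(ω, ·)` in `Q + k` are those of `f(τ_k ω, ·)` in `Q`, and invariance of `P`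
carries the almost sure hypotheses from `ω` to all `τ_k ω` at once, the lattice being countable. -/
lemma ae_cellNeutral {P : Measure Ω} [IsProbabilityMeasure P]
    [MeasurableConstVAdd (Fin d → ℤ) Ω] [VAddInvariantMeasure (Fin d → ℤ) Ω P] {q : ℝ≥0∞}
    (hq : 1 ≤ q) {f : Ω × Space d → ℂ} (hfm : Measurable f) (hf : MemLs P 2 q f)
    (hcharge : ∀ᵐ ω ∂P, cellCharge f ω = 0) (hdipole : ∀ᵐ ω ∂P, cellDipole f ω = 0) :
    ∀ᵐ ω ∂P, CellNeutral fun y => f (ω, y) := by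
  have hslice : ∀ ω, Measurable fun y => f (ω, y) := fun ω => by fun_prop
  have hint : ∀ᵐ ω ∂P, ∀ k : Fin d → ℤ, IntegrableOn (fun y => f (ω, y)) (cell k) := by
    rw [ae_all_iff]
    intro k
    have h := hf.lintegral_lintegral_enorm_lt_top hq hfm
      (isCompact_closedBall 0 (‖latticePoint (d := d) k‖ + √d))
    filter_upwards [ae_lt_top (Measurable.lintegral_prod_right' (f := fun z => ‖f z‖ₑ)
      hfm.enorm) h.ne] with ω hω
    exact ⟨(hslice ω).aestronglyMeasurable,
      (lintegral_mono_set (cell_subset_closedBall k)).trans_lt hω⟩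
  have hs := ae_all_iff.2 hf.stationary.ae_ae
  have hc : ∀ᵐ ω ∂P, ∀ k : Fin d → ℤ, cellCharge f (k +ᵥ ω) = 0 := ae_all_iff.2 fun k =>
    (measurePreserving_vadd k P).quasiMeasurePreserving.ae hcharge
  have hd : ∀ᵐ ω ∂P, ∀ k : Fin d → ℤ, cellDipole f (k +ᵥ ω) = 0 := ae_all_iff.2 fun k =>
    (measurePreserving_vadd k P).quasiMeasurePreserving.ae hdipole
  filter_upwards [hint, hs, hc, hd] with ω hi hs hc hd
  have hs' : ∀ k : Fin d → ℤ, (fun x => f (ω, latticePoint k + x))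
      =ᵐ[volume.restrict (unitCell d)] fun x => f (k +ᵥ ω, x) := fun k =>
    ae_restrict_of_ae ((hs k).mono fun x hx => hx.symm)
  have hiQ : ∀ k : Fin d → ℤ, IntegrableOn (fun x => f (k +ᵥ ω, x)) (unitCell d) := fun k =>
    (((measurePreserving_latticePoint_add k).integrable_comp_emb
      (measurableEmbedding_latticePoint_add k)).2 (hi k)).congr (hs' k)
  have hcharge0 : ∀ k : Fin d → ℤ, ∫ x in unitCell d, f (k +ᵥ ω, x) = 0 := hc
  refine ⟨hi, fun k => ?_, fun k i => ?_⟩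
  · rw [← (measurePreserving_latticePoint_add k).integral_comp
      (measurableEmbedding_latticePoint_add k), integral_congr_ae (hs' k)]
    exact hcharge0 k
  · have hdip : ∫ x in unitCell d, (x i : ℂ) * f (k +ᵥ ω, x) = 0 := congrFun (hd k) i
    rw [← (measurePreserving_latticePoint_add k).integral_comp
      (measurableEmbedding_latticePoint_add k)]
    -- Moving the origin of the dipole moment by `k` adds `k` times the charge, which vanishes.
    calc _ = ∫ x in unitCell d, ((k i : ℂ) * f (k +ᵥ ω, x) + (x i : ℂ) * f (k +ᵥ ω, x)) := by
          refine integral_congr_ae ?_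
          filter_upwards [hs' k] with x hx
          rw [hx]
          simp [latticePoint]
          ring
      _ = 0 := by
          have h2 := hiQ k
          rw [← cell_zero] at h2 hdip
          have h3 := hcharge0 k
          rw [← cell_zero] at h3 ⊢
          rw [integral_add (h2.const_mul _) (integrableOn_apply_mul_cell h2 i),
            integral_const_mul, h3, hdip]
          simp

/-- Convolution commutes with translations, and Lebesgue measure is invariant under `y ↦ k + y`. -/
lemma isStationary_yukawaConv {P : Measure Ω} [SFinite P] {f : Ω × Space d → ℂ}
    (hf : IsStationary P f) (m : ℝ) : IsStationary P (yukawaConv m f) := by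
  intro k
  refine ae_prod_of_ae_fst ?_
  filter_upwards [hf.ae_ae k] with ω hω x
  calc yukawaConv m f (k +ᵥ ω, x)
      = ∫ y, f (ω, latticePoint k + y) *
        (yukawaSqrtKernel d m (latticePoint k + x - (latticePoint k + y)) : ℂ) := by
        refine integral_congr_ae ?_
        filter_upwards [hω] with y hy
        simp only [hy, add_sub_add_left_eq_sub]
    _ = yukawaConv m f (ω, latticePoint k + x) :=
        integral_add_left_eq_self (fun y => f (ω, y) *
          (yukawaSqrtKernel d m (latticePoint k + x - y) : ℂ)) (latticePoint k)

end

end StationaryCoulomb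

/-! ### Membership in `𝒟_Y` and convergence of the energy. -/

namespace StationaryCoulomb

noncomputable section

variable {d : ℕ} {Ω : Type*} [MeasurableSpace Ω]

/-- The function `majorant * |f|`. -/
def majorantConv (f : Ω × Space d → ℂ) (z : Ω × Space d) : ℝ≥0∞ :=
  ∫⁻ y, majorant (z.2 - y) * ‖f (z.1, y)‖ₑ

lemma measurable_majorantConv {f : Ω × Space d → ℂ} (hf : Measurable f) :
    Measurable (majorantConv f) := by
  have hM := measurable_majorant (d := d)
  have h : Measurable fun p : (Ω × Space d) × Space d =>
      majorant (p.1.2 - p.2) * ‖f (p.1.1, p.2)‖ₑ :=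
    (hM.comp (by fun_prop)).mul
      (hf.comp (f := fun p : (Ω × Space d) × Space d => (p.1.1, p.2)) (by fun_prop)).enorm
  exact h.lintegral_prod_right'

/-- The exponent `r` is the one fed to the Hardy–Littlewood–Sobolev inequality: `1`, `min q 2` and
`6 / 5`. The first two are subcritical, with `(2 - r) / r < 1` for `d = 2` because `r > 1`; the last
is critical, with `d / (2r) = 5 / 4`. -/
lemma exists_exponent {q : ℝ≥0∞} (hq : (d = 1 ∧ q = 1) ∨ (d = 2 ∧ 1 < q) ∨ (d = 3 ∧ q = 6 / 5)) :
    ∃ r : ℝ, 1 ≤ r ∧ r ≤ 2 ∧ ENNReal.ofReal r ≤ q ∧ ((d : ℝ) / (2 * r) * (2 - r) < 1 ∨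
      ((d : ℝ) / (2 * r) * (2 - r) = 1 ∧ 1 < (d : ℝ) / (2 * r))) := by
  rcases hq with ⟨rfl, rfl⟩ | ⟨rfl, hq⟩ | ⟨rfl, rfl⟩
  · exact ⟨1, le_rfl, by norm_num, by simp, Or.inl (by norm_num)⟩
  · have hmin : min q 2 ≠ ∞ := ne_top_of_le_ne_top (by norm_num) (min_le_right q 2)
    have h1 : 1 < (min q 2).toReal := by
      have h : 1 < min q 2 := lt_min hq (by norm_num)
      simpa using (ENNReal.toReal_lt_toReal (by norm_num) hmin).2 h
    refine ⟨(min q 2).toReal, h1.le, ?_, ?_, Or.inl ?_⟩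
    · simpa using ENNReal.toReal_mono (by norm_num) (min_le_right q 2)
    · rw [ENNReal.ofReal_toReal hmin]
      exact min_le_left q 2
    · set r := (min q 2).toReal
      have : ((2 : ℕ) : ℝ) / (2 * r) * (2 - r) = (2 - r) / r := by
        push_cast
        field_simp
      rw [this, div_lt_one (by linarith)]
      linarith
  · refine ⟨6 / 5, by norm_num, by norm_num, ?_, Or.inr ⟨by norm_num, by norm_num⟩⟩
    rw [ENNReal.ofReal_div_of_pos (by norm_num)]
    norm_num

lemma one_le_exponent {q : ℝ≥0∞} (hq : (d = 1 ∧ q = 1) ∨ (d = 2 ∧ 1 < q) ∨ (d = 3 ∧ q = 6 / 5)) :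
    1 ≤ q := by
  obtain ⟨r, hr1, -, hrq, -⟩ := exists_exponent hq
  exact le_trans (by simpa using ENNReal.ofReal_le_ofReal hr1) hrq

variable [AddAction (Fin d → ℤ) Ω] {P : Measure Ω} [IsProbabilityMeasure P]
    [MeasurableConstVAdd (Fin d → ℤ) Ω] [VAddInvariantMeasure (Fin d → ℤ) Ω P]

lemma lintegral_majorantConv_sq_lt_top {q : ℝ≥0∞}
    (hq : (d = 1 ∧ q = 1) ∨ (d = 2 ∧ 1 < q) ∨ (d = 3 ∧ q = 6 / 5))
    {f : Ω × Space d → ℂ} (hfm : Measurable f) (hf : MemLs P 2 q f) (ρ : ℝ) :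
    ∫⁻ ω, (∫⁻ x in Metric.closedBall 0 ρ, majorantConv f (ω, x) ^ 2) ∂P < ∞ := by
  obtain ⟨r, hr1, hr2, hrq, h⟩ := exists_exponent hq
  refine lintegral_lintegral_majorant_sq_lt_top P hr1 hr2 h (F := fun ω y => ‖f (ω, y)‖ₑ)
    hfm.enorm (fun k => ?_) (fun R => ?_) ρ
  · filter_upwards [hf.stationary.ae_ae k] with ω hω
    filter_upwards [hω] with x hx
    rw [hx]
  · have := hf.lintegral_eLpNorm_sq_lt_top hrq (isCompact_closedBall 0 R)
    simpa only [eLpNorm_ofReal_sq _ _ (by linarith : 0 < r)] using this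

lemma ae_majorantConv_lt_top {q : ℝ≥0∞}
    (hq : (d = 1 ∧ q = 1) ∨ (d = 2 ∧ 1 < q) ∨ (d = 3 ∧ q = 6 / 5))
    {f : Ω × Space d → ℂ} (hfm : Measurable f) (hf : MemLs P 2 q f) :
    ∀ᵐ z ∂(P.prod volume), majorantConv f z < ∞ := by
  have hJ := measurable_majorantConv hfm
  rw [Measure.ae_prod_iff_ae_ae (measurableSet_lt hJ measurable_const)]
  have h : ∀ᵐ ω ∂P, ∀ n : ℕ, ∫⁻ x in Metric.closedBall 0 (n : ℝ), majorantConv f (ω, x) ^ 2 < ∞ :=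
    ae_all_iff.2 fun n => ae_lt_top
      (Measurable.lintegral_prod_right' (f := fun z => majorantConv f z ^ 2) (hJ.pow_const 2))
      (lintegral_majorantConv_sq_lt_top hq hfm hf n).ne
  filter_upwards [h] with ω hω
  have hJω : Measurable fun x => majorantConv f (ω, x) ^ 2 :=
    (hJ.comp (f := fun x => (ω, x)) (by fun_prop)).pow_const 2
  have h2 : ∀ᵐ x, ∀ n : ℕ, x ∈ Metric.closedBall (0 : Space d) n →
      majorantConv f (ω, x) ^ 2 < ∞ := ae_all_iff.2 fun n =>
    (ae_restrict_iff' Metric.isClosed_closedBall.measurableSet).1 (ae_lt_top hJω (hω n).ne)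
  filter_upwards [h2] with x hx
  obtain ⟨n, hn⟩ := exists_nat_ge ‖x‖
  exact (ENNReal.pow_lt_top_iff.1 (hx n (mem_closedBall_zero_iff.2 hn))).resolve_right two_ne_zero

/-- Neutrality plays no role for fixed `m`: the bound of `W_m` by a multiple of `majorant` and the
second moment estimate are enough. -/
lemma memDY_of_measurable {q : ℝ≥0∞}
    (hq : (d = 1 ∧ q = 1) ∨ (d = 2 ∧ 1 < q) ∨ (d = 3 ∧ q = 6 / 5))
    {f : Ω × Space d → ℂ} (hfm : Measurable f) (hf : MemLs P 2 q f) : MemDY P f := by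
  refine ⟨hf.memLs_one (one_le_exponent hq) hfm, fun m hm => ?_, fun m hm => ⟨?_, ?_, fun K hK => ?_⟩⟩
  · filter_upwards [ae_majorantConv_lt_top hq hfm hf] with z hz
    exact integrable_mul_yukawaSqrtKernel (f := fun y => f (z.1, y)) (by fun_prop) hz.ne hm
  · exact (stronglyMeasurable_yukawaConv hm hfm).aestronglyMeasurable
  · exact isStationary_yukawaConv hf.stationary m
  · obtain ⟨C, hC, h⟩ := exists_enorm_explicitKernel_le d hm
    obtain ⟨ρ, hρ⟩ := hK.isBounded.subset_closedBall 0
    rw [eLpNorm_two_lt_top_iff]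
    simp only [eLpNorm_two_sq]
    calc _ ≤ ∫⁻ ω, C ^ 2 * (∫⁻ x in Metric.closedBall 0 ρ, majorantConv f (ω, x) ^ 2) ∂P := by
          refine lintegral_mono fun ω => ?_
          rw [← lintegral_const_mul' _ _ (by finiteness)]
          refine (lintegral_mono_set hρ).trans (lintegral_mono fun x => ?_)
          simp only
          rw [← mul_pow]
          gcongr
          refine enorm_integral_mul_le (f := fun y => f (ω, y)) hC ?_
          filter_upwards [yukawaSqrtKernel_sub_ae_eq hm x] with y hy
          rw [hy]
          exact h _
      _ < ∞ := by
          rw [lintegral_const_mul' _ _ (by finiteness)]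
          exact ENNReal.mul_lt_top (by finiteness) (lintegral_majorantConv_sq_lt_top hq hfm hf ρ)

/-- Dominated convergence on `Ω × Q`: `|W_m * f|²` is bounded by a multiple of `(majorant * |f|)²`
independently of `m`, and the limit is the energy computed with `subtractedKernel 0`. -/
lemma exists_tendsto_yukawaEnergy {q : ℝ≥0∞}
    (hq : (d = 1 ∧ q = 1) ∨ (d = 2 ∧ 1 < q) ∨ (d = 3 ∧ q = 6 / 5))
    {f : Ω × Space d → ℂ} (hfm : Measurable f) (hf : MemLs P 2 q f)
    (hn : ∀ᵐ ω ∂P, CellNeutral fun y => f (ω, y)) :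
    ∃ D₀ : ℝ≥0, Tendsto (fun m : ℝ => yukawaEnergy P m f) (𝓝[>] 0) (𝓝 (D₀ : ℝ≥0∞)) := by
  obtain ⟨C, hC, h⟩ := exists_enorm_subtractedKernel_le d
  have hJ := measurable_majorantConv hfm
  set μ : Measure (Ω × Space d) := P.prod (volume.restrict (unitCell d)) with hμ
  have hμle : μ ≪ P.prod volume :=
    Measure.AbsolutelyContinuous.rfl.prod Measure.restrict_le_self.absolutelyContinuous
  have hfin : ∫⁻ z, (C * majorantConv f z) ^ 2 ∂μ < ∞ := by
    simp only [mul_pow]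
    rw [lintegral_const_mul' _ _ (by finiteness), lintegral_prod _ (hJ.pow_const 2).aemeasurable]
    refine ENNReal.mul_lt_top (by finiteness) ?_
    refine lt_of_le_of_lt (lintegral_mono fun ω => ?_)
      (lintegral_majorantConv_sq_lt_top hq hfm hf √d)
    exact lintegral_mono_set unitCell_subset_closedBall
  have hgood : ∀ᵐ z ∂μ, majorantConv f z < ∞ ∧ CellNeutral fun y => f (z.1, y) :=
    hμle.ae_le ((ae_majorantConv_lt_top hq hfm hf).and
      (Measure.quasiMeasurePreserving_fst.ae hn))
  have hbound : ∀ z, ∀ m, ‖∫ y, f (z.1, y) * (subtractedKernel m z.2 y : ℂ)‖ₑ ^ 2 ≤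
      (C * majorantConv f z) ^ 2 := fun z m => by
    gcongr
    exact enorm_integral_mul_le (f := fun y => f (z.1, y)) hC (ae_of_all _ (h m z.2))
  set L : ℝ≥0∞ := ∫⁻ z, ‖∫ y, f (z.1, y) * (subtractedKernel 0 z.2 y : ℂ)‖ₑ ^ 2 ∂μ with hL
  have hLfin : L < ∞ := (lintegral_mono fun z => hbound z 0).trans_lt hfin
  refine ⟨L.toNNReal, ?_⟩
  rw [ENNReal.coe_toNNReal hLfin.ne]
  have hlim : Tendsto (fun m : ℝ => ∫⁻ z, ‖yukawaConv m f z‖ₑ ^ 2 ∂μ) (𝓝[>] 0) (𝓝 L) := by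
    refine tendsto_lintegral_filter_of_dominated_convergence
      (fun z => (C * majorantConv f z) ^ 2) ?_ ?_ hfin.ne ?_
    · filter_upwards [self_mem_nhdsWithin] with m hm
      exact ((stronglyMeasurable_yukawaConv hm hfm).measurable.enorm).pow_const 2
    · filter_upwards [self_mem_nhdsWithin] with m hm
      filter_upwards [hgood] with z hz
      rw [yukawaConv, hz.2.integral_mul_yukawaSqrtKernel (by fun_prop) hz.1.ne hm]
      exact hbound z m
    · filter_upwards [hgood] with z hz
      have ht := hz.2.tendsto_integral_mul_yukawaSqrtKernel (by fun_prop) hz.1.ne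
      exact ((ENNReal.continuous_pow 2).tendsto _).comp ht.enorm
  refine hlim.congr' ?_
  filter_upwards [self_mem_nhdsWithin] with m hm
  exact lintegral_prod _
    (((stronglyMeasurable_yukawaConv hm hfm).measurable.enorm).pow_const 2).aemeasurable

end

end StationaryCoulomb

theorem proposition3p4 {d : ℕ} {Ω : Type*} [MeasurableSpace Ω] (P : Measure Ω)
    [IsProbabilityMeasure P] [AddAction (Fin d → ℤ) Ω] [MeasurableConstVAdd (Fin d → ℤ) Ω]
    [ErgodicVAdd (Fin d → ℤ) Ω P] (q : ℝ≥0∞)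
    (hq : (d = 1 ∧ q = 1) ∨ (d = 2 ∧ 1 < q) ∨ (d = 3 ∧ q = 6 / 5))
    (f : Ω × StationaryCoulomb.Space d → ℂ) (hf : StationaryCoulomb.MemLs P 2 q f)
    (hcharge : ∀ᵐ ω ∂P, StationaryCoulomb.cellCharge f ω = 0)
    (hdipole : ∀ᵐ ω ∂P, StationaryCoulomb.cellDipole f ω = 0) :
    StationaryCoulomb.MemDC P f := by
  open StationaryCoulomb in
  -- The argument runs on a jointly measurable representative `g`, so that every slice `g(ω, ·)` is
  -- measurable; the conclusion is carried back to `f` by `MemDC.congr`.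
  have hfg := hf.aestronglyMeasurable.ae_eq_mk
  have hgm := hf.aestronglyMeasurable.stronglyMeasurable_mk.measurable
  set g := hf.aestronglyMeasurable.mk f
  have hg : MemLs P 2 q g := hf.congr hfg
  have hgc : ∀ᵐ ω ∂P, cellCharge g ω = 0 := by
    filter_upwards [hcharge, ae_cellCharge_eq hfg] with ω h1 h2 using h2.symm.trans h1
  have hgd : ∀ᵐ ω ∂P, cellDipole g ω = 0 := by
    filter_upwards [hdipole, ae_cellDipole_eq hfg] with ω h1 h2 using h2.symm.trans h1
  have hmean : meanCharge P g = 0 := integral_eq_zero_of_ae hgc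
  have hDC : MemDC P g := by
    refine ⟨memDY_of_measurable hq hgm hg, ?_⟩
    -- The mean charge vanishes with the cell charges, so no background is subtracted in the energy.
    simp only [hmean, sub_zero]
    exact exists_tendsto_yukawaEnergy hq hgm hg 
      (ae_cellNeutral (one_le_exponent hq) hgm hg hgc hgd)
  exact hDC.congr hfg.symm
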